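/- **Setting.** Let $J,T>0$, $\kappa\in\mathbb C$, $\gamma\in(0,\pi/2]$, let $N\ge 2$ be even, and put $\eta=-\mathrm i\gamma$, $h_R=2J\sinh\eta$, $\nu=h_R/(NT)$, $b(\lambda)=\sinh\lambda/\sinh(\lambda+\eta)$, $$a(\lambda)=e^{\kappa/2T}\,b(-\nu-\lambda)^{N/2},\qquad d(\lambda)=e^{-\kappa/2T}\,b(\lambda-\nu)^{N/2}.$$ For a finite family (multiset) $\Lambda=\{\lambda_j\}_{j=1}^M\subset\mathbb C$ let $Q(\lambda)=\prod_{j=1}^M\sinh(\lambda-\lambda_j)$ and $$\mathfrak a_\Lambda(\lambda)=\frac{d(\lambda)\,Q(\lambda+\eta)}{a(\lambda)\,Q(\lambda-\eta)} .$$ $\Lambda$ solves the Bethe Ansatz equations of the XXZ quantum transfer matrix if $\mathfrak a_\Lambda(\lambda_j)=-1$ for $j=1,\dots,M$. Let $$\varepsilon_0^{(N)}(\lambda)=\kappa-\frac{TN}{2}\ln\Bigl(\frac{\sinh(\lambda-\nu)}{\sinh(\lambda+\nu)}\,\frac{\sinh(\lambda+\nu+\eta)}{\sinh(\lambda-\nu+\eta)}\Bigr),\qquad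 K(\lambda)=\coth(\lambda-\eta)-\coth(\lambda+\eta).$$ A *contour* is a positively oriented, piecewise $C^1$, simple closed parametrised curve $C$ in $\mathbb C$ with base point $x\in C$ (any point of the curve may serve as base point). The following condition is used in (a) and (b): * (S) for all $\lambda\in C$ and $k\in\mathbb Z$ the points $\lambda\pm\mathrm i\gamma+\mathrm i\pi k$ are outside $C$. (a) $C$ is *admissible* if (S) holds, $C$ encircles $-\nu$, which is an $N/2$-fold pole of $e^{-\varepsilon_0^{(N)}/T}$, but no other pole of this function, and no zero or pole of it lies on $C$. (b) $C$ is a *contour for* $\Lambda$ if (S) holds, $C$ encircles all $\lambda_j$ and $-\nu$, the latter being an $N/2$-fold pole of $\mathfrak a_\Lambda$, but no other root or pole of $1+\mathfrak a_\Lambda$, the multiplicity of each encircled root of $1+\mathfrak a_\Lambda$ is its multiplicity in $\Lambda$ (so the roots are simple if the $\lambda_j$ are pairwise distinct), and no roots or poles of $1+\mathfrak a_\Lambda$ and no zeros of $\mathfrak a_\Lambda$ lie on $C$. For $s\in\mathbb Z$, a function $\mathfrak a$ which is holomorphic in a neighbourhood of $C$ with $1+\mathfrak a\ne0$ on $C$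 is called a *solution for* $(s,C)$ if it satisfies the monodromy condition $$\int_C\frac{d\lambda}{2\pi\mathrm i}\,\partial_\lambda\ln(1+\mathfrak a(\lambda))=-s$$ and, for a suitable choice of the value of the logarithm $\ln\mathfrak a(\lambda)$ at each $\lambda\in C$, the nonlinear integral equation $$\ln\mathfrak a(\lambda)=-s\ln\Bigl(\frac{\sinh(\lambda-x+\eta)}{\sinh(\lambda-x-\eta)}\Bigr)-\frac{\varepsilon_0^{(N)}(\lambda)}{T}-\int_C\frac{d\mu}{2\pi\mathrm i}\,K(\lambda-\mu)\ln(1+\mathfrak a)(\mu),\qquad\lambda\in C.$$ Here $\ln(1+\mathfrak a)(\mu)$ is the integral of $\partial\ln(1+\mathfrak a)$ along $C$ in positive direction from $x$ to $\mu$ plus the principal value of $\ln(1+\mathfrak a(x))$; the other logarithms are principal values. **Theorem.** 1. If $\Lambda$ solves the Bethe Ansatz equations and $C$ is a contour for $\Lambda$, then $\mathfrak a_\Lambda$ is a solution for $(s,C)$ with $s=N/2-M$. 2. Conversely, if $C$ is admissible, $s\in\mathbb Z$, and $\mathfrak a$ is a solution for $(s,C)$, then there is exactly one solution $\Lambda$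 of the Bethe Ansatz equations such that $C$ is a contour for $\Lambda$, $\Lambda$ has $M=N/2-s$ elements (with multiplicity), and $\mathfrak a=\mathfrak a_\Lambda$ in a neighbourhood of $C$. 3. For a meromorphic function $\mathfrak a$ on $\mathbb C$ and a contour $C$ let $[C]_{\mathfrak a}$ be the class of all admissible contours that pass through no root or pole of $1+\mathfrak a$ and encircle the same roots and poles of $1+\mathfrak a$ as $C$. Then $$\Lambda\longmapsto\bigl(N/2-M,\ \{C: C\text{ is a contour for }\Lambda\}\bigr)$$ is a bijection from the set of solutions of the Bethe Ansatz equations with pairwise distinct $\lambda_j$ that possess a contour onto the set of pairs $(s,[C]_{\mathfrak a})$ in which $C$ is admissible and $\mathfrak a$ is a meromorphic function on $\mathbb C$ that is a solution for $(s,C)$ such that all roots of $1+\mathfrak a$ inside $C$ are simple. -/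

import Mathlib

open Set Filter Topology

noncomputable section

namespace XXZ

/-! ### Parametrised contours -/

/-- The winding number about the point `z` of the closed curve `g : [0,1] → ℂ`. -/
def windingNumber (g : ℝ → ℂ) (z : ℂ) : ℂ :=
  (2 * Real.pi * Complex.I)⁻¹ * ∫ t in (0 : ℝ)..1, deriv g t / (g t - z)

/-- A piecewise `C¹`, positively oriented simple closed contour, parametrised by `[0,1]`.
The last two fields express the positive orientation: the curve bounds a region, in the sense that
there is a region on which the winding number is `1`, while the winding number is `0` at all other
points off the curve. By the Jordan curve theorem every piecewise `C¹` simple closed curve has these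
two properties, possibly after a reversal of its direction. -/
structure Contour where
  toFun : ℝ → ℂ
  closed : toFun 0 = toFun 1
  simple : InjOn toFun (Ico 0 1)
  continuousOn : ContinuousOn toFun (Icc 0 1)
  piecewise_C1 : ∃ (n : ℕ) (t : ℕ → ℝ), t 0 = 0 ∧ t n = 1 ∧
    ∀ i < n, t i < t (i + 1) ∧ ContDiffOn ℝ 1 toFun (Icc (t i) (t (i + 1)))
  wind_zero_or_one : ∀ z ∉ toFun '' Icc 0 1, windingNumber toFun z = 0 ∨ windingNumber toFun z = 1
  isConnected_inside : IsConnected {z | z ∉ toFun '' Icc 0 1 ∧ windingNumber toFun z = 1}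

namespace Contour

/-- The set of points of the contour. -/
def image (C : Contour) : Set ℂ := C.toFun '' Icc 0 1

/-- The initial and final point `x_n` of the parametrisation. Any point of a given closed
contour can be made the base point by a change of the parametrisation. -/
def base (C : Contour) : ℂ := C.toFun 0

/-- The set of points encircled by the contour. -/
def inside (C : Contour) : Set ℂ := {z | z ∉ C.image ∧ windingNumber C.toFun z = 1}

/-- The set of points outside the contour. -/
def outside (C : Contour) : Set ℂ := {z | z ∉ C.image ∧ windingNumber C.toFun z = 0}

/-- The contour integral `∫_C dμ f(μ)`. -/
def integral (C : Contour) (f : ℂ → ℂ) : ℂ :=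
  ∫ t in (0 : ℝ)..1, f (C.toFun t) * deriv C.toFun t

/-- The function `ln(1 + 𝔞)` along the contour, as a function of the parameter `t`: the integral of
`∂_μ ln(1 + 𝔞(μ))` over the part of the contour from the base point `x` to the point with
parameter `t`, plus the principal value of `ln(1 + 𝔞(x))`. -/
def logOneAdd (C : Contour) (f : ℂ → ℂ) (t : ℝ) : ℂ :=
  (∫ u in (0 : ℝ)..t, deriv f (C.toFun u) / (1 + f (C.toFun u)) * deriv C.toFun u)
    + Complex.log (1 + f C.base)

end Contour

/-! ### The quantum transfer matrix data of the XXZ chain -/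

/-- Physical parameters: coupling `J`, temperature `T`, magnetic field `κ`, anisotropy parameter
`γ`, and (even) Trotter number `N`. -/
structure Params where
  J : ℝ
  T : ℝ
  κ : ℂ
  γ : ℝ
  N : ℕ
  J_pos : 0 < J
  T_pos : 0 < T
  γ_pos : 0 < γ
  γ_le : γ ≤ Real.pi / 2
  N_pos : 0 < N
  N_even : Even N

namespace Params

/-- `η = -iγ`. -/
def η (P : Params) : ℂ := -Complex.I * P.γ

/-- `h_R = 2 J sinh η`. -/
def hR (P : Params) : ℂ := 2 * P.J * Complex.sinh P.η

/-- The staggered inhomogeneities are `ν_{2j-1} = ν` and `ν_{2j} = -ν`, with `ν = h_R/(NT)`. -/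
def ν (P : Params) : ℂ := P.hR / (P.N * P.T)

/-- The twist `α = κ/T`. -/
def α (P : Params) : ℂ := P.κ / P.T

/-- The Boltzmann weight `b` of the six-vertex model. -/
def b (P : Params) (z : ℂ) : ℂ := Complex.sinh z / Complex.sinh (z + P.η)

/-- The pseudo vacuum eigenvalue `a(λ) = e^{α/2} ∏_j b(ν_{2j} - λ)`. -/
def a (P : Params) (z : ℂ) : ℂ := Complex.exp (P.α / 2) * P.b (-P.ν - z) ^ (P.N / 2)

/-- The pseudo vacuum eigenvalue `d(λ) = e^{-α/2} ∏_j b(λ - ν_{2j-1})`. -/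
def d (P : Params) (z : ℂ) : ℂ := Complex.exp (-P.α / 2) * P.b (z - P.ν) ^ (P.N / 2)

end Params

/-- `Q(λ|{λ_j}) = ∏_j sinh(λ - λ_j)`. -/
def Q (Λ : Multiset ℂ) (z : ℂ) : ℂ := (Λ.map fun x => Complex.sinh (z - x)).prod

/-- The auxiliary function `𝔞(λ) = d(λ) Q(λ + η) / (a(λ) Q(λ - η))`. -/
def aux (P : Params) (Λ : Multiset ℂ) (z : ℂ) : ℂ :=
  (P.d z * Q Λ (z + P.η)) / (P.a z * Q Λ (z - P.η))

/-- The Bethe Ansatz equations. (A vanishing denominator never gives a solution, as then the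
quotient is `0` in Lean.) -/
def IsBetheSolution (P : Params) (Λ : Multiset ℂ) : Prop :=
  ∀ x ∈ Λ, (P.d x * Q Λ (x + P.η)) / (P.a x * Q Λ (x - P.η)) = -1

/-- The driving function `ε₀^{(N)}`. -/
def ε₀ (P : Params) (z : ℂ) : ℂ :=
  P.κ - P.T * P.N / 2 * Complex.log
    (Complex.sinh (z - P.ν) / Complex.sinh (z + P.ν) *
      (Complex.sinh (z + P.ν + P.η) / Complex.sinh (z - P.ν + P.η)))

/-- The kernel `K(λ) = coth(λ - η) - coth(λ + η)`. -/
def K (P : Params) (z : ℂ) : ℂ :=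
  Complex.cosh (z - P.η) / Complex.sinh (z - P.η) - Complex.cosh (z + P.η) / Complex.sinh (z + P.η)

/-! ### Admissible contours -/

/-- For every `λ` on the contour the points `λ ± iγ` are outside the contour. As all functions
involved have period `iπ`, this is required modulo `iπ`. -/
def ShiftsOutside (P : Params) (C : Contour) : Prop :=
  ∀ z ∈ C.image, ∀ k : ℤ,
    z + P.η + k * Real.pi * Complex.I ∈ C.outside ∧ z - P.η + k * Real.pi * Complex.I ∈ C.outside

/-- A contour on which the nonlinear integral equation is considered: it encircles the point
`-h_R/(NT)`, which is an `N/2`-fold pole of `exp(-ε₀^{(N)}/T)`, and no other pole of this function;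
no zero or pole of this function is on the contour; the shifts by `±iγ` are outside. -/
structure IsDrivingContour (P : Params) (C : Contour) : Prop where
  encircles : -P.ν ∈ C.inside
  order_pole : meromorphicOrderAt (fun z => Complex.exp (-ε₀ P z / P.T)) (-P.ν) = -((P.N / 2 : ℕ) : ℤ)
  no_other_pole : ∀ z ∈ C.inside, z ≠ -P.ν →
    0 ≤ meromorphicOrderAt (fun z => Complex.exp (-ε₀ P z / P.T)) z
  on_contour : ∀ z ∈ C.image, meromorphicOrderAt (fun z => Complex.exp (-ε₀ P z / P.T)) z = 0
  shifts : ShiftsOutside P C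

/-- A contour that belongs to the Bethe roots `Λ`: it encircles all Bethe roots and the `N/2`-fold
pole of `𝔞` at `-h_R/(NT)`, but no other root or pole of `1 + 𝔞`; the multiplicity of an encircled
root of `1 + 𝔞` is its multiplicity in `Λ` (so the roots are simple if the elements of `Λ` are
pairwise distinct); there are no roots or poles of `1 + 𝔞` and no zeros of `𝔞` on the contour; the
shifts by `±iγ` are outside. -/
structure IsBetheContour (P : Params) (Λ : Multiset ℂ) (C : Contour) : Prop where
  encircles : -P.ν ∈ C.inside
  order_pole : meromorphicOrderAt (fun z => 1 + aux P Λ z) (-P.ν) = -((P.N / 2 : ℕ) : ℤ)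
  encircles_roots : ∀ x ∈ Λ, x ∈ C.inside
  order_inside : ∀ z ∈ C.inside, z ≠ -P.ν →
    meromorphicOrderAt (fun z => 1 + aux P Λ z) z = ((Λ.count z : ℕ) : ℤ)
  on_contour : ∀ z ∈ C.image, meromorphicOrderAt (fun z => 1 + aux P Λ z) z = 0 ∧
    meromorphicOrderAt (aux P Λ) z = 0
  shifts : ShiftsOutside P C

/-! ### Monodromy condition and nonlinear integral equation -/

/-- The monodromy condition `∫_C dλ/(2πi) ∂_λ ln(1 + 𝔞(λ)) = -s`. -/
def Monodromy (C : Contour) (f : ℂ → ℂ) (s : ℤ) : Prop :=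
  (2 * Real.pi * Complex.I)⁻¹ * C.integral (fun z => deriv f z / (1 + f z)) = -(s : ℂ)

/-- The nonlinear integral equation on the contour, for a branch of the logarithm of `𝔞`:
`ln 𝔞(λ) = - s ln(sinh(λ - x + η)/sinh(λ - x - η)) - ε₀(λ)/T - ∫_C dμ/(2πi) K(λ - μ) ln(1 + 𝔞)(μ)`
for all `λ ∈ C`. All other logarithms of functions of `λ` are principal values. -/
def NLIE (P : Params) (C : Contour) (f : ℂ → ℂ) (s : ℤ) : Prop :=
  ∃ lnf : ℂ → ℂ, (∀ z ∈ C.image, Complex.exp (lnf z) = f z) ∧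
    ∀ z ∈ C.image, lnf z =
      -(s : ℂ) * Complex.log
        (Complex.sinh (z - C.base + P.η) / Complex.sinh (z - C.base - P.η))
      - ε₀ P z / P.T
      - (2 * Real.pi * Complex.I)⁻¹ *
        ∫ t in (0 : ℝ)..1, K P (z - C.toFun t) * C.logOneAdd f t * deriv C.toFun t

/-- `𝔞` is a function, holomorphic on a neighbourhood of the contour, without roots of `1 + 𝔞` on
the contour, which satisfies the monodromy condition and the nonlinear integral equation. -/
structure IsSolution (P : Params) (C : Contour) (s : ℤ) (f : ℂ → ℂ) : Prop where
  analytic : AnalyticOnNhd ℂ f C.image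
  ne_zero : ∀ z ∈ C.image, 1 + f z ≠ 0
  monodromy : Monodromy C f s
  nlie : NLIE P C f s

/-! ### Equivalence classes of contours -/

/-- The equivalence class of the contour `C` with respect to the meromorphic function `𝔞`: all
contours with the general properties that pass through no root or pole of `1 + 𝔞` and encircle the
same roots and poles of `1 + 𝔞` as `C`. -/
def contourClass (P : Params) (f : ℂ → ℂ) (C : Contour) : Set Contour :=
  {C' | IsDrivingContour P C' ∧
    (∀ z ∈ C'.image, meromorphicOrderAt (fun w => 1 + f w) z = 0) ∧
    ∀ z, meromorphicOrderAt (fun w => 1 + f w) z ≠ 0 → (z ∈ C'.inside ↔ z ∈ C.inside)}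

/-- The solutions of the Bethe Ansatz equations with pairwise distinct Bethe roots that possess
a contour. -/
def betheSolutions (P : Params) : Set (Multiset ℂ) :=
  {Λ | IsBetheSolution P Λ ∧ Λ.Nodup ∧ ∃ C, IsBetheContour P Λ C}

/-- The pairs `(s, [C])` that come with a meromorphic solution `𝔞` of the monodromy condition and of
the nonlinear integral equation on `C` such that all roots of `1 + 𝔞` inside `C` are simple. -/
def spinContourPairs (P : Params) : Set (ℤ × Set Contour) :=
  {p | ∃ (f : ℂ → ℂ) (C : Contour), MeromorphicOn f univ ∧ IsDrivingContour P C ∧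
    IsSolution P C p.1 f ∧ (∀ z ∈ C.inside, meromorphicOrderAt (fun w => 1 + f w) z ≤ 1) ∧
    p.2 = contourClass P f C}

/-- The (pseudo-)spin and the set of all contours of a solution of the Bethe Ansatz equations. -/
def spinAndContours (P : Params) (Λ : Multiset ℂ) : ℤ × Set Contour :=
  (((P.N / 2 : ℕ) : ℤ) - (Λ.card : ℤ), {C | IsBetheContour P Λ C})

end XXZ

end

/-!
The engine of the proof is one identity, `HasFactorization.exp_convolution`. Suppose that
`1 + 𝔞` agrees near the contour with a meromorphic function on the closed region bounded by `C`
whose zeros `Λ` and poles `Δ` are all inside `C`. Then, with the base point `x` and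
`θ_c(λ) = sinh(λ - c + η) / sinh(λ - c - η)`,
`exp (-(2πi)⁻¹ ∫_C dμ K(λ - μ) ln(1 + 𝔞)(μ)) =
  θ_x(λ) ^ (|Δ| - |Λ|) ∏_{c ∈ Λ} θ_c(λ) / ∏_{c ∈ Δ} θ_c(λ)`
for `λ` near the region. Indeed, an integration by parts along `C` turns the derivative of the
convolution into a boundary term, given by the monodromy of `ln(1 + 𝔞)`, and an integral which the
argument principle evaluates; since `∂_λ ln θ_c(λ) = -K(λ - c)`, both sides have the same
logarithmic derivative. The constant is determined without any choice of branches: a horizontal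
ray from a point of maximal real part of the region to infinity avoids all poles of the kernel,
and both sides tend to `1` along it. The argument principle rests on Cauchy's theorem for the
region bounded by a contour, proved by Dixon's argument (`Contour.integral_div_sub`). The
condition on the shifts by `± iγ` is used for pairs of points in the closed region
(`ShiftsOutside.sinh_ne_zero`), to which it extends from the contour because no nonzero translation maps
the bounded region into itself.

The auxiliary function is `exp(-ε₀ / T)` times `∏ θ_c` over the Bethe roots, divided by `θ_{-ν}`
to the power `N / 2` (`aux_eq_drive_mul`). With `Δ = {-ν, …, -ν}`, the identity therefore says
that `𝔞_Λ` satisfies the exponential of the nonlinear integral equation, and the argument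
principle gives `s = N/2 - M` (`isSolution_aux`). Conversely, the right hand side of the integral
equation continues a solution `𝔞` meromorphically to the region, with the zeros and poles of
`exp(-ε₀ / T)`. For the multiset `Λ` of the zeros of `1 + 𝔞` inside `C`, the identity shows that
the continuation is `𝔞_Λ`, so that `Λ` solves the Bethe equations
(`IsSolution.exists_betheSolution`). Uniqueness is the identity theorem: `𝔞_Λ` determines `Λ`, as
the zeros of `1 + 𝔞_Λ` inside `C`.

In the bijection the delicate part is that the set of contours determines the Bethe roots. If `Λ₁`
and `Λ₂` have the same contours and a Bethe root `λ` of `Λ₁` is not one of `Λ₂`, then `λ` is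
neither a root or pole of `1 + 𝔞_{Λ₂}` nor a zero of `𝔞_{Λ₂}`. A contour for `Λ₂` can be pushed to
pass through `λ` (`IsBetheContour.exists_through`): the exceptional points are isolated, so their
complement in a connected neighbourhood of the region is connected, and small diffeomorphisms
`z ↦ z + ψ(z)`, with a contraction `ψ` supported in a disc without exceptional points, move the contour
along a path. Such maps preserve winding numbers (`windingNumber_perturb`). The result is not a
contour for `Λ₁`.
-/

noncomputable section

namespace XXZ

/-! ### Calculus along a contour -/

/-- A function on `[0,1]` is piecewise `C¹`, in the sense that is required of a contour. -/
def PiecewiseC1 (g : ℝ → ℂ) : Prop :=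
  ∃ (n : ℕ) (t : ℕ → ℝ), t 0 = 0 ∧ t n = 1 ∧
    ∀ i < n, t i < t (i + 1) ∧ ContDiffOn ℝ 1 g (Icc (t i) (t (i + 1)))

lemma PiecewiseC1.exists_finite_hasDerivAt {g : ℝ → ℂ} (hg : PiecewiseC1 g) :
    ∃ S : Set ℝ, S.Finite ∧ ∀ u ∈ Ioo (0 : ℝ) 1 \ S,
      HasDerivAt g (deriv g u) u ∧ ContinuousAt (deriv g) u := by
  obtain ⟨n, t, h0, h1, ht⟩ := hg
  refine ⟨t '' (Finset.range (n + 1) : Set ℕ), (Finset.finite_toSet _).image _, ?_⟩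
  rintro u ⟨⟨hu0, hu1⟩, huS⟩
  -- the first breakpoint to the right of `u` bounds the piece that contains `u`
  have hex : ∃ i, i ≤ n ∧ u < t i := ⟨n, le_rfl, by rw [h1]; exact hu1⟩
  classical
  obtain ⟨hi, hui⟩ := Nat.find_spec hex
  have hmin := fun m => Nat.find_min (H := hex) (m := m)
  set i := Nat.find hex with hidef
  have hipos : i ≠ 0 := by
    intro h
    rw [h, h0] at hui
    exact lt_asymm hu0 hui
  obtain ⟨j, hj⟩ := Nat.exists_eq_succ_of_ne_zero hipos
  have hjn : j < n := by omega
  have hju : t j < u := by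
    have := hmin j (by omega)
    have h2 : t j ≤ u := by
      by_contra hlt
      exact this ⟨hjn.le, not_le.mp hlt⟩
    refine lt_of_le_of_ne h2 fun h => huS ⟨j, by simp; omega, h⟩
  have huj : u < t (j + 1) := by rw [hj] at hui; exact hui
  have hC := (ht j hjn).2.mono (Ioo_subset_Icc_self)
  have hmem : Ioo (t j) (t (j + 1)) ∈ 𝓝 u := isOpen_Ioo.mem_nhds ⟨hju, huj⟩
  refine ⟨?_, ?_⟩
  · exact ((hC.differentiableOn one_ne_zero).differentiableAt hmem).hasDerivAt
  · exact (hC.continuousOn_deriv_of_isOpen isOpen_Ioo le_rfl).continuousAt hmem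

lemma PiecewiseC1.intervalIntegrable_deriv {g : ℝ → ℂ} (hg : PiecewiseC1 g) :
    IntervalIntegrable (deriv g) MeasureTheory.volume 0 1 := by
  obtain ⟨n, t, h0, h1, ht⟩ := hg
  rw [← h0, ← h1]
  refine IntervalIntegrable.trans_iterate fun k hk => ?_
  obtain ⟨hlt, hC⟩ := ht k hk
  have hcont : ContinuousOn (derivWithin g (Icc (t k) (t (k + 1)))) (uIcc (t k) (t (k + 1))) := by
    rw [uIcc_of_le hlt.le]
    exact hC.continuousOn_derivWithin (uniqueDiffOn_Icc hlt) le_rfl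
  refine hcont.intervalIntegrable.congr_uIoo fun x hx => ?_
  rw [uIoo_of_le hlt.le] at hx
  exact derivWithin_of_mem_nhds (Icc_mem_nhds hx.1 hx.2)

namespace Contour

lemma exists_finite_hasDerivAt (C : Contour) : ∃ S : Set ℝ, S.Finite ∧ ∀ u ∈ Ioo (0 : ℝ) 1 \ S,
    HasDerivAt C.toFun (deriv C.toFun u) u ∧ ContinuousAt (deriv C.toFun) u :=
  PiecewiseC1.exists_finite_hasDerivAt C.piecewise_C1

lemma intervalIntegrable_deriv (C : Contour) :
    IntervalIntegrable (deriv C.toFun) MeasureTheory.volume 0 1 :=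
  PiecewiseC1.intervalIntegrable_deriv C.piecewise_C1

/-- Fundamental theorem of calculus for functions which may fail to be differentiable at finitely
many parameters. -/
lemma integral_eq_sub_of_finite {F F' : ℝ → ℂ} {S : Set ℝ} (hS : S.Finite)
    (hF : ContinuousOn F (Icc 0 1)) (hF' : ∀ t ∈ Ioo (0 : ℝ) 1 \ S, HasDerivAt F (F' t) t)
    (hint : IntervalIntegrable F' MeasureTheory.volume 0 1) :
    ∫ t in (0 : ℝ)..1, F' t = F 1 - F 0 := by
  refine MeasureTheory.integral_eq_of_hasDerivAt_off_countable F F' hS.countable ?_ ?_ hint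
  · rwa [uIcc_of_le zero_le_one]
  · simpa using hF'

lemma isCompact_image (C : Contour) : IsCompact C.image :=
  isCompact_Icc.image_of_continuousOn C.continuousOn

lemma isPreconnected_image (C : Contour) : IsPreconnected C.image :=
  isPreconnected_Icc.image _ C.continuousOn

lemma mem_image {C : Contour} {t : ℝ} (ht : t ∈ Icc (0 : ℝ) 1) : C.toFun t ∈ C.image :=
  mem_image_of_mem _ ht

lemma base_mem_image (C : Contour) : C.base ∈ C.image := mem_image ⟨le_rfl, zero_le_one⟩

lemma nontrivial_image (C : Contour) : C.image.Nontrivial := by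
  refine ⟨_, mem_image (C := C) (t := 0) (by simp), _, mem_image (C := C) (t := 1 / 2)
    (by norm_num), fun h => ?_⟩
  have := C.simple (by simp) (by norm_num) h
  norm_num at this

lemma continuousOn_comp {C : Contour} {f : ℂ → ℂ} (hf : ContinuousOn f C.image) :
    ContinuousOn (fun t => f (C.toFun t)) (Icc 0 1) :=
  hf.comp C.continuousOn fun _ ht => mem_image ht

lemma intervalIntegrable_mul_deriv {C : Contour} {f : ℝ → ℂ} (hf : ContinuousOn f (Icc 0 1)) :
    IntervalIntegrable (fun t => f t * deriv C.toFun t) MeasureTheory.volume 0 1 :=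
  C.intervalIntegrable_deriv.continuousOn_mul (by rwa [uIcc_of_le zero_le_one])

/-- An integral along a contour whose integrand depends holomorphically on a parameter is
holomorphic in the parameter, and may be differentiated under the integral sign. The bound on the
derivative comes from Cauchy's estimate. -/
lemma hasDerivAt_integral (C : Contour) {Φ : ℂ → ℝ → ℂ} {z₀ : ℂ} {r M : ℝ} (hr : 0 < r)
    (hcont : ∀ z ∈ Metric.ball z₀ (2 * r), ContinuousOn (Φ z) (Icc 0 1))
    (hdiff : ∀ t ∈ Icc (0 : ℝ) 1, DifferentiableOn ℂ (fun z => Φ z t) (Metric.ball z₀ (2 * r)))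
    (hM : ∀ z ∈ Metric.ball z₀ (2 * r), ∀ t ∈ Icc (0 : ℝ) 1, ‖Φ z t‖ ≤ M) :
    IntervalIntegrable (fun t => deriv (fun z => Φ z t) z₀ * deriv C.toFun t)
      MeasureTheory.volume 0 1 ∧
    HasDerivAt (fun z => ∫ t in (0 : ℝ)..1, Φ z t * deriv C.toFun t)
      (∫ t in (0 : ℝ)..1, deriv (fun z => Φ z t) z₀ * deriv C.toFun t) z₀ := by
  have hsub : uIoc (0 : ℝ) 1 ⊆ Icc 0 1 := by
    rw [uIoc_of_le zero_le_one]; exact Ioc_subset_Icc_self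
  have hmeas : ∀ z ∈ Metric.ball z₀ (2 * r), MeasureTheory.AEStronglyMeasurable
      (fun t => Φ z t * deriv C.toFun t) (MeasureTheory.volume.restrict (uIoc 0 1)) :=
    fun z hz => (intervalIntegrable_mul_deriv (hcont z hz)).aestronglyMeasurable_restrict_uIoc
  have hball : Metric.ball z₀ (2 * r) ∈ 𝓝 z₀ := Metric.ball_mem_nhds _ (by positivity)
  have hd : ∀ t ∈ Icc (0 : ℝ) 1, ∀ z ∈ Metric.ball z₀ (2 * r),
      HasDerivAt (fun z => Φ z t) (deriv (fun z => Φ z t) z) z := fun t ht z hz =>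
    ((hdiff t ht).differentiableAt (Metric.isOpen_ball.mem_nhds hz)).hasDerivAt
  refine intervalIntegral.hasDerivAt_integral_of_dominated_loc_of_deriv_le
    (F := fun z t => Φ z t * deriv C.toFun t)
    (F' := fun z t => deriv (fun z => Φ z t) z * deriv C.toFun t)
    (bound := fun t => M / r * ‖deriv C.toFun t‖) (s := Metric.ball z₀ r)
    (Metric.ball_mem_nhds _ hr) (by filter_upwards [hball] with z hz using hmeas z hz)
    (intervalIntegrable_mul_deriv (hcont z₀ (mem_of_mem_nhds hball))) ?_ ?_
    (C.intervalIntegrable_deriv.norm.const_mul _) ?_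
  · -- the derivative is measurable, as a limit of difference quotients
    obtain ⟨u, hu⟩ := Filter.exists_seq_tendsto (𝓝[≠] z₀)
    have hslope : ∀ t ∈ Icc (0 : ℝ) 1, Tendsto (fun n => slope (fun z => Φ z t) z₀ (u n)) atTop
        (𝓝 (deriv (fun z => Φ z t) z₀)) := fun t ht =>
      (hasDerivAt_iff_tendsto_slope.1 (hd t ht z₀ (mem_of_mem_nhds hball))).comp hu
    obtain ⟨n₀, hn₀⟩ := eventually_atTop.1
      ((hu.mono_right nhdsWithin_le_nhds).eventually hball)
    refine aestronglyMeasurable_of_tendsto_ae atTop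
      (f := fun n t => slope (fun z => Φ z t) z₀ (u (n + n₀)) * deriv C.toFun t) ?_ ?_
    · intro n
      have h1 := ((hmeas (u (n + n₀)) (hn₀ _ (by omega))).sub
        (hmeas z₀ (mem_of_mem_nhds hball))).const_mul (u (n + n₀) - z₀)⁻¹
      refine h1.congr (Eventually.of_forall fun t => ?_)
      simp only [slope, vsub_eq_sub, smul_eq_mul, Pi.sub_apply]
      ring
    · refine (MeasureTheory.ae_restrict_iff' measurableSet_uIoc).2
        (Eventually.of_forall fun t ht => ?_)
      exact ((tendsto_add_atTop_iff_nat n₀).2 (hslope t (hsub ht))).mul_const _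
  · refine Eventually.of_forall fun t ht z hz => ?_
    rw [norm_mul]
    have hsub' : Metric.closedBall z r ⊆ Metric.ball z₀ (2 * r) := fun y hy => by
      simp only [Metric.mem_ball, Metric.mem_closedBall] at *
      linarith [dist_triangle y z z₀]
    gcongr
    refine Complex.norm_deriv_le_of_forall_mem_sphere_norm_le hr ?_ fun y hy =>
      hM y (hsub' (Metric.sphere_subset_closedBall hy)) t (hsub ht)
    exact ((hdiff t (hsub ht)).mono hsub').diffContOnCl_ball (subset_rfl)
  · refine Eventually.of_forall fun t ht z hz => ?_
    exact (hd t (hsub ht) z (Metric.ball_subset_ball (by linarith) hz)).mul_const _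

/-- The Cauchy integral of a function that is continuous on the contour is holomorphic off the
contour. -/
lemma differentiableAt_cauchyIntegral (C : Contour) {φ : ℂ → ℂ} (hφ : ContinuousOn φ C.image)
    {z₀ : ℂ} (hz₀ : z₀ ∉ C.image) :
    DifferentiableAt ℂ
      (fun z => ∫ t in (0 : ℝ)..1, φ (C.toFun t) / (C.toFun t - z) * deriv C.toFun t) z₀ := by
  obtain ⟨ε, hε, hball⟩ := Metric.isOpen_iff.1 C.isCompact_image.isClosed.isOpen_compl z₀ hz₀
  obtain ⟨B, hB⟩ := (C.isCompact_image.image_of_continuousOn hφ).isBounded.exists_norm_le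
  have hfar : ∀ z ∈ Metric.ball z₀ (2 * (ε / 4)), ∀ t ∈ Icc (0 : ℝ) 1,
      ε / 2 ≤ ‖C.toFun t - z‖ := by
    intro z hz t ht
    by_contra! hlt
    have hmem : C.toFun t ∈ Metric.ball z₀ ε → False := fun h => hball h (mem_image ht)
    refine hmem ?_
    rw [Metric.mem_ball] at *
    rw [← dist_eq_norm] at hlt
    linarith [dist_triangle (C.toFun t) z z₀]
  have hne : ∀ z ∈ Metric.ball z₀ (2 * (ε / 4)), ∀ t ∈ Icc (0 : ℝ) 1, C.toFun t - z ≠ 0 := by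
    intro z hz t ht h
    have := hfar z hz t ht
    rw [h, norm_zero] at this
    linarith
  refine (hasDerivAt_integral C (Φ := fun z t => φ (C.toFun t) / (C.toFun t - z)) (z₀ := z₀)
    (r := ε / 4) (M := B / (ε / 2)) (by positivity) ?_ ?_ ?_).2.differentiableAt
  · intro z hz
    exact (continuousOn_comp hφ).div (C.continuousOn.sub continuousOn_const) (hne z hz)
  · intro t ht
    exact (differentiableOn_const _).div ((differentiableOn_const _).sub differentiableOn_id)
      fun z hz => hne z hz t ht
  · intro z hz t ht
    rw [norm_div]
    have hBt := hB _ (mem_image_of_mem φ (mem_image (C := C) ht))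
    exact div_le_div₀ ((norm_nonneg _).trans hBt) hBt (by positivity) (hfar z hz t ht)

/-- The Cauchy integral tends to zero at infinity. -/
lemma tendsto_cauchyIntegral (C : Contour) {φ : ℂ → ℂ} (hφ : ContinuousOn φ C.image) :
    Tendsto (fun z => ∫ t in (0 : ℝ)..1, φ (C.toFun t) / (C.toFun t - z) * deriv C.toFun t)
      (cocompact ℂ) (𝓝 0) := by
  obtain ⟨B, hB⟩ := (C.isCompact_image.image_of_continuousOn hφ).isBounded.exists_norm_le
  obtain ⟨R, hR⟩ := C.isCompact_image.isBounded.exists_norm_le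
  have hlim : Tendsto (fun z : ℂ => (‖z‖ - R)⁻¹ * (B * ∫ t in (0 : ℝ)..1, ‖deriv C.toFun t‖))
      (cocompact ℂ) (𝓝 0) := by
    have h1 : Tendsto (fun z : ℂ => ‖z‖ - R) (cocompact ℂ) atTop :=
      tendsto_atTop_add_const_right (cocompact ℂ) (-R) (tendsto_norm_cocompact_atTop (E := ℂ))
    simpa using ((tendsto_inv_atTop_zero (𝕜 := ℝ)).comp h1).mul_const
      (B * ∫ t in (0 : ℝ)..1, ‖deriv C.toFun t‖)
  refine squeeze_zero_norm' ?_ hlim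
  filter_upwards [tendsto_norm_cocompact_atTop.eventually (eventually_gt_atTop R)] with z hz
  rw [← intervalIntegral.integral_const_mul, ← intervalIntegral.integral_const_mul]
  refine intervalIntegral.norm_integral_le_of_norm_le zero_le_one
    (Eventually.of_forall fun t ht => ?_)
    ((C.intervalIntegrable_deriv.norm.const_mul _).const_mul _)
  have ht' : t ∈ Icc (0 : ℝ) 1 := Ioc_subset_Icc_self ht
  have h1 : ‖z‖ - R ≤ ‖C.toFun t - z‖ := by
    have := norm_sub_norm_le z (C.toFun t)
    rw [norm_sub_rev] at this
    linarith [hR _ (mem_image (C := C) ht')]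
  have hBt := hB _ (mem_image_of_mem φ (mem_image (C := C) ht'))
  rw [norm_mul, norm_div, div_eq_inv_mul, mul_assoc]
  have hpos : 0 < ‖z‖ - R := sub_pos.2 hz
  gcongr

/-! ### The regions inside and outside a contour -/

lemma windingNumber_eq (C : Contour) (z : ℂ) : windingNumber C.toFun z =
    (2 * Real.pi * Complex.I)⁻¹ * ∫ t in (0 : ℝ)..1, 1 / (C.toFun t - z) * deriv C.toFun t := by
  simp [windingNumber, div_eq_inv_mul]

lemma continuousAt_windingNumber (C : Contour) {z : ℂ} (hz : z ∉ C.image) :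
    ContinuousAt (windingNumber C.toFun) z := by
  have := (C.differentiableAt_cauchyIntegral (φ := fun _ => 1) continuousOn_const hz).continuousAt
  rw [show windingNumber C.toFun = _ from funext C.windingNumber_eq]
  exact this.const_mul _

lemma isOpen_inside (C : Contour) : IsOpen C.inside := by
  rw [isOpen_iff_mem_nhds]
  rintro z ⟨hz, hw⟩
  have h1 := (C.continuousAt_windingNumber hz).eventually_ne (y := 0) (by rw [hw]; norm_num)
  filter_upwards [h1, C.isCompact_image.isClosed.isOpen_compl.mem_nhds hz] with y hy hyC
  exact ⟨hyC, (C.wind_zero_or_one y hyC).resolve_left hy⟩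

lemma isOpen_outside (C : Contour) : IsOpen C.outside := by
  rw [isOpen_iff_mem_nhds]
  rintro z ⟨hz, hw⟩
  have h1 := (C.continuousAt_windingNumber hz).eventually_ne (y := 1) (by rw [hw]; norm_num)
  filter_upwards [h1, C.isCompact_image.isClosed.isOpen_compl.mem_nhds hz] with y hy hyC
  exact ⟨hyC, (C.wind_zero_or_one y hyC).resolve_right hy⟩

lemma disjoint_inside_outside (C : Contour) : Disjoint C.inside C.outside :=
  Set.disjoint_left.2 fun _ h1 h2 => zero_ne_one (h2.2.symm.trans h1.2)

/-- The closed region bounded by a contour. -/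
def region (C : Contour) : Set ℂ := C.inside ∪ C.image

lemma inside_subset_region (C : Contour) : C.inside ⊆ C.region := subset_union_left

lemma image_subset_region (C : Contour) : C.image ⊆ C.region := subset_union_right

lemma compl_region (C : Contour) : C.regionᶜ = C.outside := by
  ext z
  simp only [region, mem_compl_iff, mem_union, not_or]
  constructor
  · rintro ⟨h1, h2⟩
    exact ⟨h2, (C.wind_zero_or_one z h2).resolve_right fun h => h1 ⟨h2, h⟩⟩
  · exact fun h => ⟨fun h1 => Set.disjoint_left.1 C.disjoint_inside_outside h1 h, h.1⟩

lemma notMem_region {C : Contour} {z : ℂ} : z ∉ C.region ↔ z ∈ C.outside := by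
  rw [← C.compl_region, mem_compl_iff]

lemma isCompact_region (C : Contour) : IsCompact C.region := by
  refine Metric.isCompact_of_isClosed_isBounded ?_ ?_
  · rw [← isOpen_compl_iff, compl_region]
    exact C.isOpen_outside
  · have hlim := (C.tendsto_cauchyIntegral (φ := fun _ => 1) continuousOn_const).const_mul
      (2 * Real.pi * Complex.I)⁻¹
    rw [mul_zero] at hlim
    have h1 := hlim.eventually_ne (b₂ := 1) zero_ne_one
    have h2 := C.isCompact_image.compl_mem_cocompact
    have h3 : C.regionᶜ ∈ cocompact ℂ := by
      filter_upwards [h1, h2] with z hz1 hz2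
      rw [compl_region]
      refine ⟨hz2, (C.wind_zero_or_one z hz2).resolve_right ?_⟩
      rwa [windingNumber_eq]
    rw [← Metric.cobounded_eq_cocompact] at h3
    exact Bornology.isBounded_def.2 h3

lemma isConnected_inside' (C : Contour) : IsConnected C.inside := C.isConnected_inside

lemma isPreconnected_region (C : Contour) : IsPreconnected C.region := by
  -- the region inside is bounded, hence not closed, so that its closure meets the contour
  have hne : (closure C.inside ∩ C.image).Nonempty := by
    by_contra hempty
    rw [not_nonempty_iff_eq_empty] at hempty
    have hcl : closure C.inside ⊆ C.region :=
      closure_minimal C.inside_subset_region C.isCompact_region.isClosed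
    have hcl' : closure C.inside ⊆ C.inside := fun z hz => (hcl hz).resolve_right fun h =>
      (Set.ext_iff.1 hempty z).1 ⟨hz, h⟩
    have hclopen : IsClopen C.inside :=
      ⟨closure_subset_iff_isClosed.1 hcl', C.isOpen_inside⟩
    rcases isClopen_iff.1 hclopen with h | h
    · exact C.isConnected_inside'.nonempty.ne_empty h
    · have h2 := C.isCompact_region.isBounded.subset C.inside_subset_region
      rw [h] at h2
      exact NormedSpace.unbounded_univ ℝ ℂ h2
  obtain ⟨p, hp, hpC⟩ := hne
  have h1 : IsPreconnected (insert p C.inside) :=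
    C.isConnected_inside'.isPreconnected.subset_closure (subset_insert _ _)
      (insert_subset hp subset_closure)
  have h2 := h1.union p (mem_insert _ _) hpC C.isPreconnected_image
  rwa [insert_union, insert_eq_of_mem (show p ∈ C.inside ∪ C.image from Or.inr hpC)] at h2

end Contour

/-! ### Cauchy's theorem for a contour -/

lemma dslope_swap (h : ℂ → ℂ) (w z : ℂ) : dslope h w z = dslope h z w := by
  rcases eq_or_ne w z with rfl | hne
  · rfl
  · rw [dslope_of_ne _ hne.symm, dslope_of_ne _ hne, slope_comm]

/-- The difference quotients `(h z - h w) / (z - w)` of a holomorphic function are bounded for `z`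
near a given point and `w` in a compact set. -/
lemma exists_norm_dslope_le {h : ℂ → ℂ} {U s : Set ℂ} (hU : IsOpen U) (hh : AnalyticOnNhd ℂ h U)
    (hs : IsCompact s) (hsU : s ⊆ U) {z₀ : ℂ} (hz₀ : z₀ ∈ U) :
    ∃ r > 0, Metric.ball z₀ (2 * r) ⊆ U ∧
      ∃ M, ∀ z ∈ Metric.ball z₀ (2 * r), ∀ w ∈ s, ‖dslope h w z‖ ≤ M := by
  obtain ⟨ε, hε, hball⟩ := Metric.nhds_basis_closedBall.mem_iff.1 (hU.mem_nhds hz₀)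
  obtain ⟨B₁, hB₁⟩ := (hs.image_of_continuousOn (hh.continuousOn.mono hsU)).isBounded.exists_norm_le
  have hK := isCompact_closedBall z₀ ε
  obtain ⟨B₂, hB₂⟩ :=
    (hK.image_of_continuousOn (hh.continuousOn.mono hball)).isBounded.exists_norm_le
  obtain ⟨B₃, hB₃⟩ :=
    (hK.image_of_continuousOn (hh.deriv.continuousOn.mono hball)).isBounded.exists_norm_le
  have hsmall : Metric.ball z₀ (2 * (ε / 4)) ⊆ Metric.closedBall z₀ ε := fun y hy => by
    rw [Metric.mem_ball] at hy
    rw [Metric.mem_closedBall]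
    linarith
  refine ⟨ε / 4, by positivity, hsmall.trans hball, max B₃ ((B₁ + B₂) / (ε / 2)), ?_⟩
  intro z hz w hw
  have hzK := hsmall hz
  by_cases hwK : w ∈ Metric.closedBall z₀ ε
  · refine le_max_of_le_left ?_
    rcases eq_or_ne z w with rfl | hne
    · rw [dslope_same]
      exact hB₃ _ (mem_image_of_mem _ hwK)
    · have h1 := (convex_closedBall z₀ ε).norm_image_sub_le_of_norm_deriv_le (𝕜 := ℂ) (f := h)
        (C := B₃) (fun x hx => (hh x (hball hx)).differentiableAt)
        (fun x hx => hB₃ _ (mem_image_of_mem _ hx)) hwK hzK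
      rw [dslope_of_ne _ hne, slope_def_field, norm_div]
      exact div_le_of_le_mul₀ (norm_nonneg _)
        ((norm_nonneg _).trans (hB₃ _ (mem_image_of_mem _ hwK))) h1
  · refine le_max_of_le_right ?_
    have hfar : ε / 2 ≤ ‖z - w‖ := by
      rw [Metric.mem_closedBall, not_le] at hwK
      rw [Metric.mem_ball] at hz
      rw [← dist_eq_norm, dist_comm]
      linarith [dist_triangle w z z₀]
    have hne : z ≠ w := by
      rintro rfl
      simp only [sub_self, norm_zero] at hfar
      linarith
    rw [dslope_of_ne _ hne, slope_def_field, norm_div]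
    have h1 := hB₁ _ (mem_image_of_mem _ hw)
    have h2 := hB₂ _ (mem_image_of_mem _ hzK)
    have h3 : ‖h z - h w‖ ≤ B₁ + B₂ := (norm_sub_le _ _).trans (by linarith)
    exact div_le_div₀ ((norm_nonneg _).trans h3) h3 (by positivity) hfar

namespace Contour

/-- **Cauchy's integral formula** for a function that is holomorphic on a neighbourhood of the
closed region bounded by a contour. The proof is Dixon's: the integral of the difference quotient
of `h` extends by the Cauchy integral of `h` to an entire function, which vanishes at infinity. -/
theorem integral_div_sub (C : Contour) {h : ℂ → ℂ} (hh : AnalyticOnNhd ℂ h C.region) {p : ℂ}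
    (hp : p ∈ C.inside) :
    C.integral (fun w => h w / (w - p)) = 2 * Real.pi * Complex.I * h p := by
  classical
  set U : Set ℂ := {z | AnalyticAt ℂ h z} with hUdef
  have hU : IsOpen U := isOpen_analyticAt ℂ h
  have hhU : AnalyticOnNhd ℂ h U := fun _ hz => hz
  have hCU : C.image ⊆ U := fun z hz => hh z (C.image_subset_region hz)
  have hcont : ContinuousOn h C.image := hhU.continuousOn.mono hCU
  have hout : ∀ z ∉ U, z ∈ C.outside := fun z hz => notMem_region.1 fun h' => hz (hh z h')
  have hds : ∀ z ∈ U, ContinuousOn (fun t => dslope h (C.toFun t) z) (Icc 0 1) := by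
    intro z hz
    simp only [fun t => dslope_swap h (C.toFun t) z]
    exact continuousOn_comp (((continuousOn_dslope (hU.mem_nhds hz)).2
      ⟨hhU.continuousOn, (hhU z hz).differentiableAt⟩).mono hCU)
  have hpi : (2 * Real.pi * Complex.I : ℂ) ≠ 0 := Complex.two_pi_I_ne_zero
  set A : ℂ → ℂ := fun z => ∫ t in (0 : ℝ)..1, h (C.toFun t) / (C.toFun t - z) * deriv C.toFun t
    with hA
  set D : ℂ → ℂ := fun z => ∫ t in (0 : ℝ)..1, dslope h (C.toFun t) z * deriv C.toFun t with hD
  have hDA : ∀ z ∉ C.image,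
      D z = A z - 2 * Real.pi * Complex.I * windingNumber C.toFun z * h z := by
    intro z hz
    have hne : ∀ t ∈ Icc (0 : ℝ) 1, C.toFun t - z ≠ 0 := fun t ht h0 =>
      hz (by rw [← sub_eq_zero.1 h0]; exact mem_image ht)
    have hsub : ContinuousOn (fun t => C.toFun t - z) (Icc 0 1) :=
      C.continuousOn.sub continuousOn_const
    rw [windingNumber_eq, ← mul_assoc, mul_inv_cancel₀ hpi, one_mul,
      ← intervalIntegral.integral_mul_const, hA, hD, ← intervalIntegral.integral_sub]
    · refine intervalIntegral.integral_congr fun t ht => ?_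
      rw [uIcc_of_le zero_le_one] at ht
      have h1 := hne t ht
      have h2 : z ≠ C.toFun t := fun h0 => h1 (by rw [h0, sub_self])
      have h3 : z - C.toFun t ≠ 0 := sub_ne_zero.2 h2
      rw [dslope_of_ne _ h2, slope_def_field]
      field_simp
      ring
    · exact intervalIntegrable_mul_deriv ((continuousOn_comp hcont).div hsub hne)
    · exact (intervalIntegrable_mul_deriv (continuousOn_const.div hsub hne)).mul_const _
  set H : ℂ → ℂ := fun z => if z ∈ U then D z else A z with hH
  have hHout : ∀ z ∈ C.outside, H z = A z := by
    intro z hz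
    by_cases hzU : z ∈ U
    · simp only [hH, hzU, if_true]
      rw [hDA z hz.1, hz.2]
      ring
    · simp only [hH, hzU, if_false]
  have hHdiff : Differentiable ℂ H := by
    intro z₀
    by_cases hz₀ : z₀ ∈ U
    · obtain ⟨r, hr, hrU, M, hM⟩ := exists_norm_dslope_le hU hhU C.isCompact_image hCU hz₀
      have h1 := (hasDerivAt_integral C (Φ := fun z t => dslope h (C.toFun t) z) hr
        (fun z hz => hds z (hrU hz)) (fun t ht => ?_)
        (fun z hz t ht => hM z hz _ (mem_image ht))).2.differentiableAt
      · refine h1.congr_of_eventuallyEq ?_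
        filter_upwards [hU.mem_nhds hz₀] with z hz
        simp only [hH, hz, if_true, hD]
      · exact ((Complex.differentiableOn_dslope (hU.mem_nhds (hCU (mem_image ht)))).2
          hhU.differentiableOn).mono hrU
    · refine (C.differentiableAt_cauchyIntegral hcont (hout z₀ hz₀).1).congr_of_eventuallyEq ?_
      filter_upwards [C.isOpen_outside.mem_nhds (hout z₀ hz₀)] with z hz
      exact hHout z hz
  have hlim : Tendsto H (cocompact ℂ) (𝓝 0) := by
    refine (C.tendsto_cauchyIntegral hcont).congr' ?_
    filter_upwards [C.isCompact_region.compl_mem_cocompact] with z hz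
    rw [compl_region] at hz
    exact (hHout z hz).symm
  have hzero : H p = 0 := hHdiff.apply_eq_of_tendsto_cocompact p hlim
  have hpU : p ∈ U := hh p (C.inside_subset_region hp)
  simp only [hH, hpU, if_true] at hzero
  rw [hDA p hp.1, hp.2] at hzero
  change A p = _
  linear_combination hzero

/-- **Cauchy's theorem** for a function that is holomorphic on a neighbourhood of the closed region
bounded by a contour. -/
theorem integral_eq_zero (C : Contour) {h : ℂ → ℂ} (hh : AnalyticOnNhd ℂ h C.region) :
    C.integral h = 0 := by
  obtain ⟨p, hp⟩ := C.isConnected_inside'.nonempty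
  have h1 := C.integral_div_sub (h := fun w => h w * (w - p))
    (fun z hz => (hh z hz).mul (analyticAt_id.sub analyticAt_const)) hp
  simp only [sub_self, mul_zero] at h1
  rw [← h1]
  refine intervalIntegral.integral_congr fun t ht => ?_
  rw [uIcc_of_le zero_le_one] at ht
  have hne : C.toFun t - p ≠ 0 := fun h0 => hp.1 (by rw [← sub_eq_zero.1 h0]; exact mem_image ht)
  dsimp only
  rw [mul_div_cancel_right₀ _ hne]

end Contour

/-! ### Translates of the region bounded by a contour -/

lemma sinh_eq_zero_iff {z : ℂ} : Complex.sinh z = 0 ↔ ∃ k : ℤ, z = k * Real.pi * Complex.I := by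
  have h1 : Complex.sinh z = 0 ↔ Complex.sin (z * Complex.I) = 0 := by
    rw [Complex.sin_mul_I]
    simp
  rw [h1, Complex.sin_eq_zero_iff]
  constructor
  · rintro ⟨k, hk⟩
    refine ⟨-k, ?_⟩
    push_cast
    linear_combination (-Complex.I) * hk + z * Complex.I_mul_I
  · rintro ⟨k, hk⟩
    refine ⟨-k, ?_⟩
    push_cast
    rw [hk]
    linear_combination (k * Real.pi : ℂ) * Complex.I_mul_I

lemma Params.sinh_η_ne_zero (P : Params) : Complex.sinh P.η ≠ 0 := by
  have h1 : Complex.sinh P.η = -(Complex.I * Real.sin P.γ) := by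
    rw [Params.η, neg_mul, Complex.sinh_neg, mul_comm, Complex.sinh_mul_I, Complex.ofReal_sin]
    ring
  rw [h1, neg_ne_zero]
  refine mul_ne_zero Complex.I_ne_zero
    (Complex.ofReal_ne_zero.2 (Real.sin_pos_of_pos_of_lt_pi P.γ_pos ?_).ne')
  linarith [P.γ_le, Real.pi_pos]

namespace Contour

/-- If a contour can be translated by `c` and by `-c` into its own exterior, then so can the region
that it bounds: otherwise the connected set `inside + c` would lie inside the contour, and then so
would all `inside + k * c`. -/
lemma add_mem_outside {C : Contour} {c : ℂ} (hc : c ≠ 0)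
    (h : ∀ z ∈ C.image, z + c ∈ C.outside ∧ z - c ∈ C.outside) {w : ℂ} (hw : w ∈ C.region) :
    w + c ∈ C.outside := by
  rcases hw with hw | hw
  swap
  · exact (h w hw).1
  by_contra hcon
  have hcover : (fun z => z + c) '' C.inside ⊆ C.inside ∪ C.outside := by
    rintro _ ⟨z, hz, rfl⟩
    have h1 : z + c ∉ C.image := fun h2 => by
      have := (h _ h2).2
      rw [add_sub_cancel_right] at this
      exact Set.disjoint_left.1 C.disjoint_inside_outside hz this
    by_cases h3 : z + c ∈ C.region
    · exact Or.inl (h3.resolve_right h1)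
    · exact Or.inr (notMem_region.1 h3)
  have hmem : w + c ∈ C.inside := (hcover (mem_image_of_mem _ hw)).resolve_right hcon
  have hsub : (fun z => z + c) '' C.inside ⊆ C.inside :=
    IsPreconnected.subset_left_of_subset_union C.isOpen_inside C.isOpen_outside
      C.disjoint_inside_outside hcover ⟨w + c, mem_image_of_mem _ hw, hmem⟩
      (C.isConnected_inside'.isPreconnected.image _ (continuous_add_const c).continuousOn)
  have hiter : ∀ k : ℕ, w + k * c ∈ C.inside := by
    intro k
    induction k with
    | zero => simpa using hw
    | succ k ih =>
      have := hsub (mem_image_of_mem _ ih)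
      push_cast
      convert this using 1
      ring
  obtain ⟨R, hR⟩ := (C.isCompact_region.isBounded.subset C.inside_subset_region).exists_norm_le
  obtain ⟨k, hk⟩ := exists_nat_gt ((R + ‖w‖) / ‖c‖)
  have h1 := hR _ (hiter k)
  have h2 : (k : ℝ) * ‖c‖ ≤ ‖w + k * c‖ + ‖w‖ := by
    have := norm_sub_le (w + k * c) w
    rw [add_sub_cancel_left, norm_mul, Complex.norm_natCast] at this
    exact this
  rw [div_lt_iff₀ (norm_pos_iff.2 hc)] at hk
  linarith

end Contour

lemma ShiftsOutside.region {P : Params} {C : Contour} (h : ShiftsOutside P C) {w : ℂ}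
    (hw : w ∈ C.region) (k : ℤ) :
    w + P.η + k * Real.pi * Complex.I ∈ C.outside ∧
      w - P.η + k * Real.pi * Complex.I ∈ C.outside := by
  have hne : ∀ k : ℤ, P.η + k * Real.pi * Complex.I ≠ 0 := fun k h0 =>
    P.sinh_η_ne_zero (sinh_eq_zero_iff.2 ⟨-k, by push_cast; linear_combination h0⟩)
  constructor
  · have := Contour.add_mem_outside (C := C) (hne k) (fun z hz => ⟨?_, ?_⟩) hw
    · rwa [← add_assoc] at this
    · rw [← add_assoc]
      exact (h z hz k).1
    · convert (h z hz (-k)).2 using 1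
      push_cast
      ring
  · have := Contour.add_mem_outside (C := C) (neg_ne_zero.2 (hne (-k))) (fun z hz => ⟨?_, ?_⟩) hw
    · convert this using 1
      push_cast
      ring
    · convert (h z hz k).2 using 1
      push_cast
      ring
    · convert (h z hz (-k)).1 using 1
      ring

/-- The zeros of `sinh (z - μ ± η)` are avoided by points `z`, `μ` of the closed region. -/
lemma ShiftsOutside.sinh_ne_zero {P : Params} {C : Contour} (h : ShiftsOutside P C) {z μ : ℂ}
    (hz : z ∈ C.region) (hμ : μ ∈ C.region) :
    Complex.sinh (z - μ - P.η) ≠ 0 ∧ Complex.sinh (z - μ + P.η) ≠ 0 := by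
  constructor
  · intro h0
    obtain ⟨k, hk⟩ := sinh_eq_zero_iff.1 h0
    refine Contour.notMem_region.2 ((h.region hμ k).1) ?_
    rwa [show μ + P.η + k * Real.pi * Complex.I = z by rw [← hk]; ring]
  · intro h0
    obtain ⟨k, hk⟩ := sinh_eq_zero_iff.1 h0
    refine Contour.notMem_region.2 ((h.region hμ k).2) ?_
    rwa [show μ - P.η + k * Real.pi * Complex.I = z by rw [← hk]; ring]

/-! ### Logarithmic derivatives and the argument principle -/

lemma logDeriv_multiset_prod {ι : Type*} (s : Multiset ι) (g : ι → ℂ → ℂ) {z : ℂ}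
    (hne : ∀ i ∈ s, g i z ≠ 0) (hd : ∀ i ∈ s, DifferentiableAt ℂ (g i) z) :
    DifferentiableAt ℂ (fun y => (s.map fun i => g i y).prod) z ∧
      logDeriv (fun y => (s.map fun i => g i y).prod) z =
        (s.map fun i => logDeriv (g i) z).sum := by
  induction s using Multiset.induction_on with
  | empty => simp
  | cons a s ih =>
    obtain ⟨ih1, ih2⟩ := ih (fun i hi => hne i (Multiset.mem_cons_of_mem hi))
      (fun i hi => hd i (Multiset.mem_cons_of_mem hi))
    have hne' : (s.map fun i => g i z).prod ≠ 0 := by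
      refine Multiset.prod_ne_zero fun h0 => ?_
      obtain ⟨i, hi, h⟩ := Multiset.mem_map.1 h0
      exact hne i (Multiset.mem_cons_of_mem hi) h
    have ha := hd a (Multiset.mem_cons_self a s)
    simp only [Multiset.map_cons, Multiset.prod_cons, Multiset.sum_cons]
    refine ⟨ha.mul ih1, ?_⟩
    rw [logDeriv_mul z (hne a (Multiset.mem_cons_self a s)) hne' ha ih1, ih2]

namespace Contour

lemma integral_sum_div_sub (C : Contour) {φ : ℂ → ℂ} (hφ : AnalyticOnNhd ℂ φ C.region)
    (Λ : Multiset ℂ) (hΛ : ∀ x ∈ Λ, x ∈ C.inside) :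
    ContinuousOn (fun z => φ z * (Λ.map fun x => (z - x)⁻¹).sum) C.image ∧
      C.integral (fun z => φ z * (Λ.map fun x => (z - x)⁻¹).sum) =
        2 * Real.pi * Complex.I * (Λ.map φ).sum := by
  have hcφ : ContinuousOn φ C.image := hφ.continuousOn.mono C.image_subset_region
  induction Λ using Multiset.induction_on with
  | empty => simp [integral, continuousOn_const]
  | cons a s ih =>
    obtain ⟨ih1, ih2⟩ := ih (fun i hi => hΛ i (Multiset.mem_cons_of_mem hi))
    have ha := hΛ a (Multiset.mem_cons_self a s)
    have hc : ContinuousOn (fun z => φ z * (z - a)⁻¹) C.image :=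
      hcφ.mul ((continuousOn_id.sub continuousOn_const).inv₀ fun z hz h0 =>
        ha.1 (sub_eq_zero.1 (show z - a = 0 from h0) ▸ hz))
    simp only [Multiset.map_cons, Multiset.sum_cons, mul_add]
    refine ⟨hc.add ih1, ?_⟩
    rw [← ih2, ← C.integral_div_sub hφ ha]
    simp only [integral, div_eq_mul_inv, add_mul]
    exact intervalIntegral.integral_add (intervalIntegrable_mul_deriv (continuousOn_comp hc))
      (intervalIntegrable_mul_deriv (continuousOn_comp ih1))

end Contour

namespace Contour

variable {C : Contour} {f : ℂ → ℂ}

lemma continuousOn_deriv_div (hf : AnalyticOnNhd ℂ f C.image) (h0 : ∀ z ∈ C.image, 1 + f z ≠ 0) :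
    ContinuousOn (fun z => deriv f z / (1 + f z)) C.image :=
  hf.deriv.continuousOn.div (continuousOn_const.add hf.continuousOn) h0

lemma intervalIntegrable_deriv_div (hf : AnalyticOnNhd ℂ f C.image)
    (h0 : ∀ z ∈ C.image, 1 + f z ≠ 0) : IntervalIntegrable
    (fun t => deriv f (C.toFun t) / (1 + f (C.toFun t)) * deriv C.toFun t)
    MeasureTheory.volume 0 1 :=
  intervalIntegrable_mul_deriv (continuousOn_comp (continuousOn_deriv_div hf h0))

lemma continuousOn_logOneAdd (hf : AnalyticOnNhd ℂ f C.image) (h0 : ∀ z ∈ C.image, 1 + f z ≠ 0) :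
    ContinuousOn (C.logOneAdd f) (Icc 0 1) := by
  have := intervalIntegral.continuousOn_primitive_interval'
    (intervalIntegrable_deriv_div hf h0) (a := 0) left_mem_uIcc
  rw [uIcc_of_le zero_le_one] at this
  exact this.add continuousOn_const

end Contour

/-- The function `1 + f` has on a neighbourhood of the closed region the zeros `Λ` and the poles
`Δ`, all of them inside the contour, and `w` is its remaining factor. The function `f` itself
matters only near the contour. -/
structure HasFactorization (C : Contour) (f w : ℂ → ℂ) (Λ Δ : Multiset ℂ) : Prop where
  analytic : AnalyticOnNhd ℂ f C.image
  ne_zero : ∀ z ∈ C.image, 1 + f z ≠ 0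
  analytic_factor : AnalyticOnNhd ℂ w C.region
  factor_ne_zero : ∀ z ∈ C.region, w z ≠ 0
  zeros_inside : ∀ x ∈ Λ, x ∈ C.inside
  poles_inside : ∀ x ∈ Δ, x ∈ C.inside
  eq : ∀ z ∈ C.image, ∀ᶠ y in 𝓝 z,
    (1 + f y) * (Δ.map fun x => y - x).prod = (Λ.map fun x => y - x).prod * w y

namespace HasFactorization

variable {C : Contour} {f w : ℂ → ℂ} {Λ Δ : Multiset ℂ}

lemma deriv_div (hf : HasFactorization C f w Λ Δ) {z : ℂ} (hz : z ∈ C.image) :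
    deriv f z / (1 + f z) =
      (Λ.map fun x => (z - x)⁻¹).sum - (Δ.map fun x => (z - x)⁻¹).sum + logDeriv w z := by
  have hlin : ∀ s : Multiset ℂ, (∀ x ∈ s, x ∈ C.inside) →
      DifferentiableAt ℂ (fun y => (s.map fun x => y - x).prod) z ∧
      (s.map fun x => z - x).prod ≠ 0 ∧
      logDeriv (fun y => (s.map fun x => y - x).prod) z = (s.map fun x => (z - x)⁻¹).sum := by
    intro s hs
    have hne : ∀ x ∈ s, z - x ≠ 0 := fun x hx h0 =>
      (hs x hx).1 (by rw [← sub_eq_zero.1 h0]; exact hz)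
    have h1 := logDeriv_multiset_prod s (fun x y => y - x) (z := z) hne
      (fun x _ => by fun_prop)
    refine ⟨h1.1, ?_, ?_⟩
    · refine Multiset.prod_ne_zero fun h0 => ?_
      obtain ⟨i, hi, h⟩ := Multiset.mem_map.1 h0
      exact hne i hi h
    · rw [h1.2]
      congr 1
      refine Multiset.map_congr rfl fun x _ => ?_
      simp [logDeriv_apply]
  obtain ⟨hd1, hn1, hl1⟩ := hlin Λ hf.zeros_inside
  obtain ⟨hd2, hn2, hl2⟩ := hlin Δ hf.poles_inside
  have hzr := C.image_subset_region hz
  have hfd := (hf.analytic z hz).differentiableAt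
  have h0 : (fun y => (1 + f y) * (Δ.map fun x => y - x).prod) =ᶠ[𝓝 z]
      fun y => (Λ.map fun x => y - x).prod * w y := hf.eq z hz
  have h1 : logDeriv (fun y => (1 + f y) * (Δ.map fun x => y - x).prod) z =
      logDeriv (fun y => (Λ.map fun x => y - x).prod * w y) z :=
    by rw [logDeriv_apply, logDeriv_apply, h0.deriv_eq, h0.eq_of_nhds]
  rw [logDeriv_mul z (hf.ne_zero z hz) hn2 (by fun_prop) hd2,
    logDeriv_mul z hn1 (hf.factor_ne_zero z hzr) hd1
      (hf.analytic_factor z hzr).differentiableAt, hl1, hl2] at h1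
  have h2 : logDeriv (fun y => 1 + f y) z = deriv f z / (1 + f z) := by
    rw [logDeriv_apply, deriv_const_add]
  rw [h2] at h1
  linear_combination h1

/-- The weighted **argument principle**. -/
lemma integral_mul (hf : HasFactorization C f w Λ Δ) {φ : ℂ → ℂ}
    (hφ : AnalyticOnNhd ℂ φ C.region) :
    C.integral (fun z => φ z * (deriv f z / (1 + f z))) =
      2 * Real.pi * Complex.I * ((Λ.map φ).sum - (Δ.map φ).sum) := by
  have hw : AnalyticOnNhd ℂ (fun z => φ z * logDeriv w z) C.region := fun z hz =>
    (hφ z hz).mul ((hf.analytic_factor z hz).deriv.div (hf.analytic_factor z hz)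
      (hf.factor_ne_zero z hz))
  obtain ⟨hc1, hi1⟩ := C.integral_sum_div_sub hφ Λ hf.zeros_inside
  obtain ⟨hc2, hi2⟩ := C.integral_sum_div_sub hφ Δ hf.poles_inside
  have hc3 := hw.continuousOn.mono C.image_subset_region
  have hi3 := C.integral_eq_zero hw
  have hI1 := C.intervalIntegrable_mul_deriv (Contour.continuousOn_comp hc1)
  have hI2 := C.intervalIntegrable_mul_deriv (Contour.continuousOn_comp hc2)
  have hI3 := C.intervalIntegrable_mul_deriv (Contour.continuousOn_comp hc3)
  rw [mul_sub, ← hi1, ← hi2, ← add_zero (_ - _), ← hi3]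
  simp only [Contour.integral]
  rw [← intervalIntegral.integral_sub hI1 hI2, ← intervalIntegral.integral_add (hI1.sub hI2) hI3]
  refine intervalIntegral.integral_congr fun t ht => ?_
  rw [uIcc_of_le zero_le_one] at ht
  rw [hf.deriv_div (Contour.mem_image ht)]
  ring

lemma integral_deriv_div (hf : HasFactorization C f w Λ Δ) :
    C.integral (fun z => deriv f z / (1 + f z)) =
      2 * Real.pi * Complex.I * ((Λ.card : ℂ) - (Δ.card : ℂ)) := by
  have := hf.integral_mul (φ := fun _ => 1) fun _ _ => analyticAt_const
  simpa using this

lemma monodromy_iff (hf : HasFactorization C f w Λ Δ) (s : ℤ) :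
    Monodromy C f s ↔ s = (Δ.card : ℤ) - (Λ.card : ℤ) := by
  rw [Monodromy, hf.integral_deriv_div, inv_mul_cancel_left₀ Complex.two_pi_I_ne_zero]
  constructor
  · intro h
    have h2 : (s : ℂ) = ((Δ.card : ℤ) - (Λ.card : ℤ) : ℤ) := by
      push_cast
      linear_combination h
    exact_mod_cast h2
  · rintro rfl
    push_cast
    ring

lemma logOneAdd_sub (hf : HasFactorization C f w Λ Δ) :
    C.logOneAdd f 1 - C.logOneAdd f 0 =
      2 * Real.pi * Complex.I * ((Λ.card : ℂ) - (Δ.card : ℂ)) := by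
  rw [← hf.integral_deriv_div]
  simp [Contour.logOneAdd, Contour.integral]

lemma hasDerivAt_logOneAdd (hf : HasFactorization C f w Λ Δ) {t : ℝ} (ht : t ∈ Ioo (0 : ℝ) 1)
    (hC : ContinuousAt C.toFun t) (hC' : ContinuousAt (deriv C.toFun) t) :
    HasDerivAt (C.logOneAdd f)
      (deriv f (C.toFun t) / (1 + f (C.toFun t)) * deriv C.toFun t) t := by
  refine HasDerivAt.add_const _ ?_
  have htI : t ∈ Icc (0 : ℝ) 1 := Ioo_subset_Icc_self ht
  have hint := Contour.intervalIntegrable_deriv_div hf.analytic hf.ne_zero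
  refine intervalIntegral.integral_hasDerivAt_right
    (hint.mono_set (by
      rw [uIcc_of_le zero_le_one, uIcc_of_le htI.1]; exact Icc_subset_Icc_right htI.2)) ?_ ?_
  · exact ⟨Ioc 0 1, Ioc_mem_nhds ht.1 ht.2, hint.1.aestronglyMeasurable⟩
  · have hz := Contour.mem_image (C := C) htI
    have h1 : ContinuousAt (fun z => deriv f z / (1 + f z)) (C.toFun t) :=
      (hf.analytic _ hz).deriv.continuousAt.div
        (continuousAt_const.add (hf.analytic _ hz).continuousAt) (hf.ne_zero _ hz)
    exact (ContinuousAt.comp (f := C.toFun) h1 hC).mul hC'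

end HasFactorization

/-! ### The convolution of the kernel with `ln (1 + 𝔞)` -/

/-- The scattering factor `sinh (z - c + η) / sinh (z - c - η)`. Its logarithmic derivative with
respect to `z` is `-K (z - c)`. -/
def scatter (P : Params) (c z : ℂ) : ℂ :=
  Complex.sinh (z - c + P.η) / Complex.sinh (z - c - P.η)

/-- The points `z` for which `μ ↦ K (z - μ)` has no pole in the closed region. -/
def regularSet (P : Params) (C : Contour) : Set ℂ :=
  {z | ∀ μ ∈ C.region, Complex.sinh (z - μ - P.η) ≠ 0 ∧ Complex.sinh (z - μ + P.η) ≠ 0}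

/-- The convolution `∫_C dμ K(z - μ) ln(1 + f)(μ)`. -/
def convolution (P : Params) (C : Contour) (f : ℂ → ℂ) (z : ℂ) : ℂ :=
  ∫ t in (0 : ℝ)..1, K P (z - C.toFun t) * C.logOneAdd f t * deriv C.toFun t

section Kernel

variable {P : Params} {C : Contour}

lemma analyticAt_K {z : ℂ} (h1 : Complex.sinh (z - P.η) ≠ 0) (h2 : Complex.sinh (z + P.η) ≠ 0) :
    AnalyticAt ℂ (K P) z :=
  .sub (.div (by fun_prop) (by fun_prop) h1) (.div (by fun_prop) (by fun_prop) h2)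

lemma isOpen_regularSet : IsOpen (regularSet P C) := by
  rw [isOpen_iff_mem_nhds]
  intro z hz
  have hopen : IsOpen {p : ℂ × ℂ | Complex.sinh (p.1 - p.2 - P.η) ≠ 0 ∧
      Complex.sinh (p.1 - p.2 + P.η) ≠ 0} :=
    (isOpen_ne_fun (by fun_prop) continuous_const).inter
      (isOpen_ne_fun (by fun_prop) continuous_const)
  obtain ⟨u, v, hu, -, hzu, hv, huv⟩ := generalized_tube_lemma (isCompact_singleton (x := z))
    C.isCompact_region hopen (fun q hq => by
      have h1 := hz q.2 hq.2
      rwa [← mem_singleton_iff.1 hq.1] at h1)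
  filter_upwards [hu.mem_nhds (singleton_subset_iff.1 hzu)] with y hy μ hμ
  exact huv (mk_mem_prod hy (hv hμ))

lemma scatter_ne_zero {z c : ℂ} (hz : z ∈ regularSet P C) (hc : c ∈ C.region) :
    scatter P c z ≠ 0 := div_ne_zero (hz c hc).2 (hz c hc).1

lemma analyticAt_scatter {z c : ℂ} (hz : Complex.sinh (z - c - P.η) ≠ 0) :
    AnalyticAt ℂ (scatter P c) z :=
  .div (by fun_prop) (by fun_prop) hz

lemma logDeriv_scatter {z c : ℂ} (hz : z ∈ regularSet P C) (hc : c ∈ C.region) :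
    logDeriv (scatter P c) z = -K P (z - c) := by
  obtain ⟨h1, h2⟩ := hz c hc
  have hd : ∀ a : ℂ,
      HasDerivAt (fun z => Complex.sinh (z - c + a)) (Complex.cosh (z - c + a)) z := by
    intro a
    have := (((hasDerivAt_id z).sub_const c).add_const a).csinh
    simpa using this
  have hd2 : HasDerivAt (fun z => Complex.sinh (z - c - P.η)) (Complex.cosh (z - c - P.η)) z := by
    simpa [sub_eq_add_neg] using hd (-P.η)
  have h3 : logDeriv (scatter P c) z = _ :=
    logDeriv_div z h2 h1 (hd P.η).differentiableAt hd2.differentiableAt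
  rw [h3, logDeriv_apply, logDeriv_apply, (hd _).deriv, hd2.deriv, K]
  ring

/-- The expression in product form for `exp (-(2πi)⁻¹ ∫_C dμ K(z - μ) ln(1 + f)(μ))`. -/
def scatterProd (P : Params) (x : ℂ) (s : ℤ) (Λ Δ : Multiset ℂ) (z : ℂ) : ℂ :=
  scatter P x z ^ s * (Λ.map fun c => scatter P c z).prod / (Δ.map fun c => scatter P c z).prod

lemma multiset_prod_ne_zero {ι : Type*} {s : Multiset ι} {g : ι → ℂ} (h : ∀ i ∈ s, g i ≠ 0) :
    (s.map g).prod ≠ 0 := by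
  refine Multiset.prod_ne_zero fun h0 => ?_
  obtain ⟨i, hi, h'⟩ := Multiset.mem_map.1 h0
  exact h i hi h'

lemma scatterProd_ne_zero {x : ℂ} {s : ℤ} {Λ Δ : Multiset ℂ} {z : ℂ} (hz : z ∈ regularSet P C)
    (hx : x ∈ C.region) (hΛ : ∀ c ∈ Λ, c ∈ C.region) (hΔ : ∀ c ∈ Δ, c ∈ C.region) :
    scatterProd P x s Λ Δ z ≠ 0 :=
  div_ne_zero (mul_ne_zero (zpow_ne_zero _ (scatter_ne_zero hz hx))
    (multiset_prod_ne_zero fun c hc => scatter_ne_zero hz (hΛ c hc)))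
    (multiset_prod_ne_zero fun c hc => scatter_ne_zero hz (hΔ c hc))

lemma logDeriv_scatterProd {x : ℂ} {s : ℤ} {Λ Δ : Multiset ℂ} {z : ℂ} (hz : z ∈ regularSet P C)
    (hx : x ∈ C.region) (hΛ : ∀ c ∈ Λ, c ∈ C.region) (hΔ : ∀ c ∈ Δ, c ∈ C.region) :
    DifferentiableAt ℂ (scatterProd P x s Λ Δ) z ∧
    logDeriv (scatterProd P x s Λ Δ) z = -(s * K P (z - x)) -
      (Λ.map fun c => K P (z - c)).sum + (Δ.map fun c => K P (z - c)).sum := by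
  have hdiff : ∀ c ∈ C.region, DifferentiableAt ℂ (scatter P c) z := fun c hc =>
    (analyticAt_scatter (hz c hc).1).differentiableAt
  have hprod : ∀ S : Multiset ℂ, (∀ c ∈ S, c ∈ C.region) →
      DifferentiableAt ℂ (fun z => (S.map fun c => scatter P c z).prod) z ∧
      logDeriv (fun z => (S.map fun c => scatter P c z).prod) z =
        -(S.map fun c => K P (z - c)).sum := by
    intro S hS
    have h1 := logDeriv_multiset_prod S (scatter P) (fun c hc => scatter_ne_zero hz (hS c hc))
      fun c hc => hdiff c (hS c hc)
    refine ⟨h1.1, h1.2.trans ?_⟩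
    rw [Multiset.map_congr rfl fun c hc => logDeriv_scatter hz (hS c hc), Multiset.sum_map_neg]
  obtain ⟨d1, l1⟩ := hprod Λ hΛ
  obtain ⟨d2, l2⟩ := hprod Δ hΔ
  have n1 := multiset_prod_ne_zero fun c hc => scatter_ne_zero hz (hΛ c hc)
  have n2 := multiset_prod_ne_zero fun c hc => scatter_ne_zero hz (hΔ c hc)
  have n3 : scatter P x z ^ s ≠ 0 := zpow_ne_zero _ (scatter_ne_zero hz hx)
  have d3 : DifferentiableAt ℂ (fun z => scatter P x z ^ s) z :=
    (hdiff x hx).zpow (Or.inl (scatter_ne_zero hz hx))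
  refine ⟨(d3.mul d1).div d2 n2, ?_⟩
  have h4 : logDeriv (scatterProd P x s Λ Δ) z = _ :=
    logDeriv_div z (mul_ne_zero n3 n1) n2 (d3.mul d1) d2
  have h5 : logDeriv (fun z => scatter P x z ^ s * (Λ.map fun c => scatter P c z).prod) z = _ :=
    logDeriv_mul z n3 n1 d3 d1
  rw [h4, h5, l1, l2, logDeriv_fun_zpow (hdiff x hx), logDeriv_scatter hz hx]
  ring

lemma ShiftsOutside.region_subset_regularSet (h : ShiftsOutside P C) :
    C.region ⊆ regularSet P C := fun _ hz _ hμ => h.sinh_ne_zero hz hμ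

end Kernel

lemma hasDerivAt_convolution_integral {P : Params} {C : Contour} {f : ℂ → ℂ}
    (hL : ContinuousOn (C.logOneAdd f) (Icc 0 1)) {z : ℂ} (hz : z ∈ regularSet P C) :
    IntervalIntegrable (fun t => deriv (fun y => K P (y - C.toFun t) * C.logOneAdd f t) z *
      deriv C.toFun t) MeasureTheory.volume 0 1 ∧
    HasDerivAt (convolution P C f)
      (∫ t in (0 : ℝ)..1, deriv (fun y => K P (y - C.toFun t) * C.logOneAdd f t) z *
        deriv C.toFun t) z := by
  obtain ⟨ε, hε, hball⟩ := Metric.nhds_basis_closedBall.mem_iff.1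
    ((isOpen_regularSet (P := P) (C := C)).mem_nhds hz)
  have hK : ∀ y ∈ regularSet P C, ∀ μ ∈ C.region, AnalyticAt ℂ (K P) (y - μ) :=
    fun y hy μ hμ => analyticAt_K (hy μ hμ).1 (hy μ hμ).2
  have hcont : ContinuousOn (fun p : ℂ × ℝ => K P (p.1 - C.toFun p.2) * C.logOneAdd f p.2)
      (Metric.closedBall z ε ×ˢ Icc 0 1) := by
    refine ContinuousOn.mul ?_ (hL.comp continuousOn_snd fun p hp => hp.2)
    intro p hp
    have h1 := (hK p.1 (hball hp.1) _ (C.image_subset_region (Contour.mem_image hp.2))).continuousAt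
    refine ContinuousAt.comp_continuousWithinAt
      (f := fun p : ℂ × ℝ => p.1 - C.toFun p.2) h1 ?_
    exact (continuousOn_fst.sub (C.continuousOn.comp continuousOn_snd fun p hp => hp.2)) p hp
  obtain ⟨M, hM⟩ :=
    ((isCompact_closedBall z ε).prod isCompact_Icc).exists_bound_of_continuousOn hcont
  have hsub : Metric.ball z (2 * (ε / 2)) ⊆ Metric.closedBall z ε := by
    rw [mul_div_cancel₀ _ two_ne_zero]
    exact Metric.ball_subset_closedBall
  have hcont1 : ∀ y ∈ Metric.ball z (2 * (ε / 2)),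
      ContinuousOn (fun t => K P (y - C.toFun t) * C.logOneAdd f t) (Icc 0 1) := fun y hy =>
    hcont.comp (f := fun t : ℝ => (y, t)) (by fun_prop) fun t ht => ⟨hsub hy, ht⟩
  have hdiff1 : ∀ t ∈ Icc (0 : ℝ) 1, DifferentiableOn ℂ
      (fun y => K P (y - C.toFun t) * C.logOneAdd f t) (Metric.ball z (2 * (ε / 2))) := by
    intro t ht y hy
    have h1 := (hK y (hball (hsub hy)) _
      (C.image_subset_region (Contour.mem_image ht))).differentiableAt
    have h2 : DifferentiableAt ℂ (fun y => K P (y - C.toFun t)) y :=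
      DifferentiableAt.comp y (f := fun y => y - C.toFun t) h1 (by fun_prop)
    exact (h2.mul_const _).differentiableWithinAt
  have hM1 : ∀ y ∈ Metric.ball z (2 * (ε / 2)), ∀ t ∈ Icc (0 : ℝ) 1,
      ‖K P (y - C.toFun t) * C.logOneAdd f t‖ ≤ M := fun y hy t ht =>
    hM (y, t) ⟨hsub hy, ht⟩
  exact C.hasDerivAt_integral (Φ := fun y t => K P (y - C.toFun t) * C.logOneAdd f t)
    (z₀ := z) (r := ε / 2) (M := M) (by positivity) hcont1 hdiff1 hM1

namespace HasFactorization

variable {P : Params} {C : Contour} {f w : ℂ → ℂ} {Λ Δ : Multiset ℂ}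

/-- Differentiation of the convolution under the integral sign and an integration by parts along
the contour: the boundary term comes from the monodromy of `ln (1 + f)`, the remaining integral is
a sum over zeros and poles. -/
lemma hasDerivAt_convolution (hf : HasFactorization C f w Λ Δ) {z : ℂ}
    (hz : z ∈ regularSet P C) :
    HasDerivAt (convolution P C f)
      (2 * Real.pi * Complex.I * ((Λ.map fun c => K P (z - c)).sum -
        (Δ.map fun c => K P (z - c)).sum - ((Λ.card : ℂ) - Δ.card) * K P (z - C.base))) z := by
  have hK : ∀ y ∈ regularSet P C, ∀ μ ∈ C.region, AnalyticAt ℂ (K P) (y - μ) :=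
    fun y hy μ hμ => analyticAt_K (hy μ hμ).1 (hy μ hμ).2
  have hL := Contour.continuousOn_logOneAdd hf.analytic hf.ne_zero
  obtain ⟨hint, hder⟩ := hasDerivAt_convolution_integral hL hz
  refine hder.congr_deriv ?_
  have hdK : ∀ t ∈ Icc (0 : ℝ) 1, HasDerivAt (K P) (deriv (K P) (z - C.toFun t)) (z - C.toFun t) :=
    fun t ht =>
      (hK z hz _ (C.image_subset_region (Contour.mem_image ht))).differentiableAt.hasDerivAt
  have hder' : ∀ t ∈ Icc (0 : ℝ) 1, deriv (fun y => K P (y - C.toFun t) * C.logOneAdd f t) z =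
      deriv (K P) (z - C.toFun t) * C.logOneAdd f t := by
    intro t ht
    have h1 := (HasDerivAt.comp z (h := fun y => y - C.toFun t) (hdK t ht)
      ((hasDerivAt_id z).sub_const _)).mul_const (C.logOneAdd f t)
    simpa using h1.deriv
  have hKφ : AnalyticOnNhd ℂ (fun μ => K P (z - μ)) C.region := fun μ hμ =>
    (hK z hz μ hμ).fun_comp (by fun_prop)
  have harg := hf.integral_mul hKφ
  have hKc := hKφ.continuousOn.mono C.image_subset_region
  have hint2 : IntervalIntegrable (fun t => K P (z - C.toFun t) *
      (deriv f (C.toFun t) / (1 + f (C.toFun t))) * deriv C.toFun t) MeasureTheory.volume 0 1 :=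
    C.intervalIntegrable_mul_deriv
    (Contour.continuousOn_comp (hKc.mul (Contour.continuousOn_deriv_div hf.analytic hf.ne_zero)))
  obtain ⟨S, hS, hSd⟩ := C.exists_finite_hasDerivAt
  -- integration by parts
  have hparts := Contour.integral_eq_sub_of_finite (S := S) hS
    (F := fun t => K P (z - C.toFun t) * C.logOneAdd f t)
    (F' := fun t => K P (z - C.toFun t) * (deriv f (C.toFun t) / (1 + f (C.toFun t))) *
        deriv C.toFun t -
      deriv (fun y => K P (y - C.toFun t) * C.logOneAdd f t) z * deriv C.toFun t)
    ((Contour.continuousOn_comp hKc).mul hL) ?_ (hint2.sub hint)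
  · rw [intervalIntegral.integral_sub hint2 hint] at hparts
    simp only [Contour.integral] at harg
    rw [harg, ← C.closed, ← mul_sub, hf.logOneAdd_sub] at hparts
    simp only [Contour.base]
    linear_combination -hparts
  · intro t ht
    have htI : t ∈ Icc (0 : ℝ) 1 := Ioo_subset_Icc_self ht.1
    obtain ⟨hC1, hC2⟩ := hSd t ht
    have h1 := HasDerivAt.comp t (h := fun t => z - C.toFun t) (hdK t htI) (hC1.const_sub z)
    have h2 := h1.mul (hf.hasDerivAt_logOneAdd ht.1 hC1.continuousAt hC2)
    rw [hder' t htI]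
    refine h2.congr_deriv ?_
    simp only [Function.comp_apply]
    ring

end HasFactorization

/-! ### Behaviour at infinity -/

lemma Params.re_η (P : Params) : P.η.re = 0 := by simp [Params.η]

lemma sinh_re_le_norm_sinh (y : ℂ) : Real.sinh y.re ≤ ‖Complex.sinh y‖ := by
  rw [Complex.sinh, Real.sinh_eq, norm_div]
  have h := norm_sub_norm_le (Complex.exp y) (Complex.exp (-y))
  rw [Complex.norm_exp, Complex.norm_exp, Complex.neg_re] at h
  simpa using div_le_div_of_nonneg_right h zero_le_two

lemma le_norm_sinh {P : Params} {y : ℂ} {t : ℝ} (ht : 0 < t) (hy : t ≤ y.re) :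
    t ≤ ‖Complex.sinh (y - P.η)‖ ∧ t ≤ ‖Complex.sinh (y + P.η)‖ := by
  have h1 : t ≤ Real.sinh y.re := hy.trans (Real.self_le_sinh_iff.2 (ht.le.trans hy))
  constructor
  · refine (h1.trans_eq ?_).trans (sinh_re_le_norm_sinh _)
    simp [P.re_η]
  · refine (h1.trans_eq ?_).trans (sinh_re_le_norm_sinh _)
    simp [P.re_η]

lemma norm_K_le {P : Params} {y : ℂ} {t : ℝ} (ht : 0 < t) (hy : t ≤ y.re) :
    ‖K P y‖ ≤ ‖Complex.sinh (2 * P.η)‖ * (t * t)⁻¹ := by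
  obtain ⟨h1, h2⟩ := le_norm_sinh (P := P) ht hy
  have n1 : Complex.sinh (y - P.η) ≠ 0 := norm_pos_iff.1 (ht.trans_le h1)
  have n2 : Complex.sinh (y + P.η) ≠ 0 := norm_pos_iff.1 (ht.trans_le h2)
  have hK : K P y = Complex.sinh (2 * P.η) / (Complex.sinh (y - P.η) * Complex.sinh (y + P.η)) := by
    rw [K, div_sub_div _ _ n1 n2, show 2 * P.η = (y + P.η) - (y - P.η) by ring,
      Complex.sinh_sub (y + P.η) (y - P.η)]
    ring
  rw [hK, norm_div, norm_mul, div_eq_mul_inv]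
  gcongr

/-- The convolution vanishes at infinity along a horizontal ray which starts at a point of maximal
real part of the region. -/
lemma HasFactorization.tendsto_convolution {P : Params} {C : Contour} {f w : ℂ → ℂ}
    {Λ Δ : Multiset ℂ} (hf : HasFactorization C f w Λ Δ) {p : ℂ}
    (hp : ∀ μ ∈ C.region, μ.re ≤ p.re) :
    Tendsto (fun t : ℝ => convolution P C f (p + t)) atTop (𝓝 0) := by
  set B := ∫ t in (0 : ℝ)..1, ‖C.logOneAdd f t * deriv C.toFun t‖
  have hlim : Tendsto (fun t : ℝ => ‖Complex.sinh (2 * P.η)‖ * (t * t)⁻¹ * B) atTop (𝓝 0) := by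
    have h1 : Tendsto (fun t : ℝ => (t * t)⁻¹) atTop (𝓝 0) :=
      (tendsto_inv_atTop_zero (𝕜 := ℝ)).comp (tendsto_id.atTop_mul_atTop₀ tendsto_id)
    simpa using (h1.const_mul ‖Complex.sinh (2 * P.η)‖).mul_const B
  refine squeeze_zero_norm' ?_ hlim
  filter_upwards [eventually_gt_atTop 0] with t ht
  rw [← intervalIntegral.integral_const_mul]
  refine intervalIntegral.norm_integral_le_of_norm_le zero_le_one
    (Eventually.of_forall fun u hu => ?_)
    ((C.intervalIntegrable_mul_deriv
      (Contour.continuousOn_logOneAdd hf.analytic hf.ne_zero)).norm.const_mul _)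
  rw [mul_assoc, norm_mul]
  refine mul_le_mul_of_nonneg_right (norm_K_le ht ?_) (norm_nonneg _)
  have := hp _ (C.image_subset_region (Contour.mem_image (Ioc_subset_Icc_self hu)))
  simp only [Complex.sub_re, Complex.add_re, Complex.ofReal_re]
  linarith

lemma tendsto_scatter (P : Params) (c p : ℂ) :
    Tendsto (fun t : ℝ => scatter P c (p + t)) atTop (𝓝 (Complex.exp (2 * P.η))) := by
  have hexp : Tendsto (fun t : ℝ => Complex.exp (-2 * t)) atTop (𝓝 0) := by
    have h1 : Tendsto (fun t : ℝ => Real.exp (-2 * t)) atTop (𝓝 0) :=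
      Real.tendsto_exp_atBot.comp (tendsto_id.const_mul_atTop_of_neg (by norm_num))
    have h2 := (Complex.continuous_ofReal.tendsto 0).comp h1
    refine (h2.congr fun t => ?_)
    simp [Complex.ofReal_exp]
  have hlim : ∀ a : ℂ, Tendsto
      (fun t : ℝ => Complex.exp a - Complex.exp (-a) * Complex.exp (-2 * t)) atTop
      (𝓝 (Complex.exp a)) := fun a => by
    simpa using (hexp.const_mul (Complex.exp (-a))).const_sub (Complex.exp a)
  have hsinh : ∀ (a : ℂ) (t : ℝ), Complex.sinh (a + t) =
      Complex.exp t / 2 * (Complex.exp a - Complex.exp (-a) * Complex.exp (-2 * t)) := by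
    intro a t
    have h1 : Complex.exp (-(a + t)) =
        Complex.exp t * (Complex.exp (-a) * Complex.exp (-2 * t)) := by
      rw [← Complex.exp_add, ← Complex.exp_add]
      congr 1
      ring
    rw [Complex.sinh, h1, Complex.exp_add]
    ring
  have h := (hlim (p - c + P.η)).div (hlim (p - c - P.η)) (Complex.exp_ne_zero _)
  rw [← Complex.exp_sub, show p - c + P.η - (p - c - P.η) = 2 * P.η by ring] at h
  refine h.congr fun t => ?_
  rw [scatter, show p + t - c + P.η = p - c + P.η + t by ring,
    show p + t - c - P.η = p - c - P.η + t by ring, hsinh, hsinh,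
    mul_div_mul_left _ _ (div_ne_zero (Complex.exp_ne_zero _) two_ne_zero)]
  rfl

lemma tendsto_multiset_prod_scatter (P : Params) (p : ℂ) (Λ : Multiset ℂ) :
    Tendsto (fun t : ℝ => (Λ.map fun c => scatter P c (p + t)).prod) atTop
      (𝓝 (Complex.exp (2 * P.η) ^ Λ.card)) := by
  induction Λ using Multiset.induction_on with
  | empty => simp
  | cons a s ih =>
    simp only [Multiset.map_cons, Multiset.prod_cons, Multiset.card_cons]
    rw [pow_succ']
    exact (tendsto_scatter P a p).mul ih

/-- The exponent of the factor at the base point is the one for which the limits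
`exp (2 η)` of the single factors cancel. -/
lemma tendsto_scatterProd (P : Params) (x p : ℂ) (Λ Δ : Multiset ℂ) :
    Tendsto (fun t : ℝ => scatterProd P x ((Δ.card : ℤ) - Λ.card) Λ Δ (p + t)) atTop (𝓝 1) := by
  have hne := Complex.exp_ne_zero (2 * P.η)
  have h := (((tendsto_scatter P x p).zpow₀ ((Δ.card : ℤ) - Λ.card) (Or.inl hne)).mul
    (tendsto_multiset_prod_scatter P p Λ)).div (tendsto_multiset_prod_scatter P p Δ)
    (pow_ne_zero _ hne)
  rw [zpow_sub₀ hne, zpow_natCast, zpow_natCast, div_mul_cancel₀ _ (pow_ne_zero _ hne),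
    div_self (pow_ne_zero _ hne)] at h
  exact h

/-! ### Evaluation of the convolution -/

/-- The convolution of the kernel with `ln (1 + f)`, in terms of the zeros and poles of `1 + f`
inside the contour. Both sides have the same logarithmic derivative; that the constant of
integration is `1` is seen by following a ray, which starts at a point of maximal real part of the
region, to infinity, where both sides tend to `1`. -/
theorem HasFactorization.exp_convolution {P : Params} {C : Contour} {f w : ℂ → ℂ}
    {Λ Δ : Multiset ℂ} (hf : HasFactorization C f w Λ Δ) (hS : ShiftsOutside P C) {z : ℂ}
    (hz : z ∈ C.region) : ∀ᶠ y in 𝓝 z,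
      Complex.exp (-((2 * Real.pi * Complex.I)⁻¹ * convolution P C f y)) =
        scatterProd P C.base ((Δ.card : ℤ) - Λ.card) Λ Δ y := by
  have hW := isOpen_regularSet (P := P) (C := C)
  have hsub := hS.region_subset_regularSet
  have hx := C.image_subset_region C.base_mem_image
  have hΛ := fun c hc => C.inside_subset_region (hf.zeros_inside c hc)
  have hΔ := fun c hc => C.inside_subset_region (hf.poles_inside c hc)
  obtain ⟨p, hp, hmax⟩ := C.isCompact_region.exists_isMaxOn ⟨z, hz⟩
    Complex.continuous_re.continuousOn
  have hmax' : ∀ μ ∈ C.region, μ.re ≤ p.re := fun μ hμ => hmax hμ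
  have hray : ∀ t : ℝ, 0 ≤ t → p + t ∈ regularSet P C := by
    intro t ht
    rcases ht.eq_or_lt with rfl | ht
    · simpa using hsub hp
    · intro μ hμ
      have h1 : t ≤ (p + t - μ).re := by
        simp only [Complex.sub_re, Complex.add_re, Complex.ofReal_re]
        linarith [hmax' μ hμ]
      obtain ⟨h2, h3⟩ := le_norm_sinh (P := P) ht h1
      exact ⟨norm_pos_iff.1 (ht.trans_le h2), norm_pos_iff.1 (ht.trans_le h3)⟩
  set V := connectedComponentIn (regularSet P C) p with hV
  have hVsub : V ⊆ regularSet P C := connectedComponentIn_subset _ _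
  have hVopen : IsOpen V := hW.connectedComponentIn
  have hVconn : IsPreconnected V := isPreconnected_connectedComponentIn
  have hregV : C.region ⊆ V := C.isPreconnected_region.subset_connectedComponentIn hp hsub
  have hrayV : ∀ t : ℝ, 0 ≤ t → p + t ∈ V := by
    have h1 : IsPreconnected ((fun t : ℝ => p + t) '' Ici 0) :=
      isPreconnected_Ici.image _ (by fun_prop)
    have h2 := h1.subset_connectedComponentIn (x := p) ⟨0, by simp, by simp⟩
      (F := regularSet P C) (by rintro _ ⟨t, ht, rfl⟩; exact hray t ht)
    exact fun t ht => h2 ⟨t, ht, rfl⟩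
  set s : ℤ := (Δ.card : ℤ) - Λ.card with hs
  set E : ℂ → ℂ := fun y => Complex.exp (-((2 * Real.pi * Complex.I)⁻¹ * convolution P C f y))
    with hE
  set R : ℂ → ℂ := scatterProd P C.base s Λ Δ with hR
  have hRne : ∀ y ∈ V, R y ≠ 0 := fun y hy => scatterProd_ne_zero (hVsub hy) hx hΛ hΔ
  have hΦ : ∀ y ∈ V, DifferentiableAt ℂ (fun y => E y / R y) y ∧
      deriv (fun y => E y / R y) y = 0 := by
    intro y hy
    obtain ⟨hRd, hRl⟩ := logDeriv_scatterProd (s := s) (hVsub hy) hx hΛ hΔ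
    have hG := ((hf.hasDerivAt_convolution (hVsub hy)).const_mul
      (2 * Real.pi * Complex.I : ℂ)⁻¹).neg.cexp
    have hEd : DifferentiableAt ℂ E y := hG.differentiableAt
    have hEne : E y ≠ 0 := Complex.exp_ne_zero _
    refine ⟨hEd.div hRd (hRne y hy), ?_⟩
    have hEl : logDeriv E y = -((2 * Real.pi * Complex.I)⁻¹ * (2 * Real.pi * Complex.I *
        ((Λ.map fun c => K P (y - c)).sum - (Δ.map fun c => K P (y - c)).sum -
          ((Λ.card : ℂ) - Δ.card) * K P (y - C.base)))) := by
      rw [logDeriv_apply]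
      have h2 : deriv E y = _ := hG.deriv
      rw [h2]
      exact mul_div_cancel_left₀ _ hEne
    have h1 : logDeriv (fun y => E y / R y) y = 0 := by
      rw [logDeriv_div y hEne (hRne y hy) hEd hRd, hEl, hRl,
        inv_mul_cancel_left₀ Complex.two_pi_I_ne_zero, hs]
      push_cast
      ring
    rw [logDeriv_apply, div_eq_zero_iff] at h1
    exact h1.resolve_right (div_ne_zero hEne (hRne y hy))
  have hconst : ∀ y ∈ V, E y / R y = E p / R p := fun y hy =>
    hVopen.is_const_of_deriv_eq_zero hVconn (fun y hy => (hΦ y hy).1.differentiableWithinAt)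
      (fun y hy => (hΦ y hy).2) hy (hregV hp)
  have hlim : Tendsto (fun t : ℝ => E (p + t) / R (p + t)) atTop (𝓝 1) := by
    have h1 : Tendsto (fun t : ℝ => E (p + t)) atTop (𝓝 1) := by
      have h2 := ((hf.tendsto_convolution (P := P) hmax').const_mul
        (2 * Real.pi * Complex.I : ℂ)⁻¹).neg.cexp
      rwa [mul_zero, neg_zero, Complex.exp_zero] at h2
    rw [← div_one (1 : ℂ)]
    exact h1.div (tendsto_scatterProd P C.base p Λ Δ) one_ne_zero
  have hone : E p / R p = 1 := by
    refine tendsto_nhds_unique (tendsto_const_nhds.congr' ?_) hlim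
    filter_upwards [eventually_ge_atTop 0] with t ht
    exact (hconst _ (hrayV t ht)).symm
  filter_upwards [hVopen.mem_nhds (hregV hz)] with y hy
  have := (hconst y hy).trans hone
  exact (div_eq_one_iff_eq (hRne y hy)).1 this

/-! ### Orders of meromorphic functions -/

lemma meromorphicOrderAt_one_add_of_neg {f : ℂ → ℂ} {z : ℂ} (hf : meromorphicOrderAt f z < 0) :
    meromorphicOrderAt (fun y => 1 + f y) z = meromorphicOrderAt f z := by
  have h1 : meromorphicOrderAt (fun _ : ℂ => (1 : ℂ)) z = 0 := by
    classical
    rw [meromorphicOrderAt_const, if_neg one_ne_zero]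
  exact meromorphicOrderAt_add_eq_right_of_lt (f₁ := fun _ => (1 : ℂ)) (f₂ := f)
    (MeromorphicAt.const 1 z) (by rwa [h1])

lemma meromorphicOrderAt_of_one_add_neg {f : ℂ → ℂ} {z : ℂ}
    (hf : meromorphicOrderAt (fun y => 1 + f y) z < 0) :
    meromorphicOrderAt f z = meromorphicOrderAt (fun y => 1 + f y) z := by
  have h1 : meromorphicOrderAt (fun _ : ℂ => (-1 : ℂ)) z = 0 := by
    classical
    rw [meromorphicOrderAt_const, if_neg (neg_ne_zero.2 one_ne_zero)]
  have h2 := meromorphicOrderAt_add_eq_right_of_lt (f₁ := fun _ => (-1 : ℂ))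
    (f₂ := fun y => 1 + f y) (x := z) (MeromorphicAt.const (-1) z) (by rwa [h1])
  rw [← h2]
  refine meromorphicOrderAt_congr (Eventually.of_forall fun y => ?_)
  simp

lemma meromorphicOrderAt_one_add_nonneg {f : ℂ → ℂ} {z : ℂ} (hf : 0 ≤ meromorphicOrderAt f z) :
    0 ≤ meromorphicOrderAt (fun y => 1 + f y) z := by
  by_contra! h
  rw [meromorphicOrderAt_of_one_add_neg h] at hf
  exact absurd h (not_lt.2 hf)

lemma meromorphicOrderAt_nonneg_of_one_add {f : ℂ → ℂ} {z : ℂ}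
    (hf : 0 ≤ meromorphicOrderAt (fun y => 1 + f y) z) : 0 ≤ meromorphicOrderAt f z := by
  by_contra! h
  rw [meromorphicOrderAt_one_add_of_neg h] at hf
  exact absurd h (not_lt.2 hf)

lemma meromorphicOrderAt_eq_zero_iff_ne_zero {f : ℂ → ℂ} {z : ℂ} (hf : AnalyticAt ℂ f z) :
    meromorphicOrderAt f z = 0 ↔ f z ≠ 0 :=
  hf.meromorphicNFAt.meromorphicOrderAt_eq_zero_iff

/-- The identity theorem for meromorphic functions on the plane. -/
lemma eventuallyEq_nhdsNE_of_meromorphic {f g : ℂ → ℂ} (hf : MeromorphicOn f univ)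
    (hg : MeromorphicOn g univ) {z₀ : ℂ} (h : f =ᶠ[𝓝[≠] z₀] g) (z : ℂ) : f =ᶠ[𝓝[≠] z] g := by
  have h0 : meromorphicOrderAt (f - g) z₀ = ⊤ :=
    meromorphicOrderAt_eq_top_iff.2 (h.mono fun y hy => by simp [hy])
  have h1 : meromorphicOrderAt (f - g) z = ⊤ := by
    by_contra hne
    exact (hf.sub hg).meromorphicOrderAt_ne_top_of_isPreconnected isPreconnected_univ
      (mem_univ z) (mem_univ z₀) hne h0
  exact (meromorphicOrderAt_eq_top_iff.1 h1).mono fun y hy => by simpa [sub_eq_zero] using hy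

lemma meromorphicOrderAt_one_add_congr {f g : ℂ → ℂ} {z : ℂ} (h : f =ᶠ[𝓝[≠] z] g) :
    meromorphicOrderAt (fun y => 1 + f y) z = meromorphicOrderAt (fun y => 1 + g y) z :=
  meromorphicOrderAt_congr (h.mono fun y hy => by simp [hy])

open Classical in
lemma meromorphicOrderAt_sub_const (z x : ℂ) :
    meromorphicOrderAt (fun y => y - x) z = if z = x then 1 else 0 := by
  split_ifs with h
  · rw [h]
    exact meromorphicOrderAt_id_sub_const
  · exact (meromorphicOrderAt_eq_zero_iff_ne_zero (by fun_prop)).2 (sub_ne_zero.2 h)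

lemma analyticAt_multiset_prod {ι : Type*} (s : Multiset ι) {g : ι → ℂ → ℂ} {z : ℂ}
    (hg : ∀ i ∈ s, AnalyticAt ℂ (g i) z) :
    AnalyticAt ℂ (fun y => (s.map fun i => g i y).prod) z := by
  induction s using Multiset.induction_on with
  | empty => simpa using analyticAt_const
  | cons a s ih =>
    simp only [Multiset.map_cons, Multiset.prod_cons]
    exact (hg a (Multiset.mem_cons_self a s)).mul
      (ih fun i hi => hg i (Multiset.mem_cons_of_mem hi))

lemma meromorphicOrderAt_prod_sub (Λ : Multiset ℂ) (z : ℂ) :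
    meromorphicOrderAt (fun y => (Λ.map fun x => y - x).prod) z =
      ((Λ.count z : ℤ) : WithTop ℤ) := by
  induction Λ using Multiset.induction_on with
  | empty =>
    simp only [Multiset.map_zero, Multiset.prod_zero, Multiset.count_zero]
    classical
    rw [meromorphicOrderAt_const, if_neg one_ne_zero]
    rfl
  | cons a s ih =>
    have h1 : meromorphicOrderAt (fun y => (y - a) * (s.map fun x => y - x).prod) z = _ :=
      meromorphicOrderAt_mul (f := fun y => y - a) (by fun_prop)
        (analyticAt_multiset_prod s (g := fun x y => y - x) fun i _ => by fun_prop).meromorphicAt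
    simp only [Multiset.map_cons, Multiset.prod_cons]
    classical
    rw [h1, ih, meromorphicOrderAt_sub_const, Multiset.count_cons]
    split_ifs with h
    · push_cast
      rw [add_comm]
    · simp

/-! ### Factorization on the closed region -/

/-- A meromorphic function `1 + F` on the closed region, all of whose zeros and poles are inside
the contour, factorizes. The remaining factor is the normal form of the quotient of `1 + F` by a
rational function with the same zeros and poles. -/
lemma exists_hasFactorization {C : Contour} {f F : ℂ → ℂ} {Λ Δ : Multiset ℂ}
    (hmer : MeromorphicOn F C.region)
    (hord : ∀ z ∈ C.region,
      meromorphicOrderAt (fun y => 1 + F y) z = ((Λ.count z - Δ.count z : ℤ) : WithTop ℤ))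
    (hΛ : ∀ x ∈ Λ, x ∈ C.inside) (hΔ : ∀ x ∈ Δ, x ∈ C.inside) (hf : AnalyticOnNhd ℂ f C.image)
    (hfF : ∀ z ∈ C.image, f =ᶠ[𝓝[≠] z] F) :
    ∃ w, HasFactorization C f w Λ Δ := by
  have hpoly : ∀ (S : Multiset ℂ) (z : ℂ), AnalyticAt ℂ (fun y => (S.map fun x => y - x).prod) z :=
    fun S z => analyticAt_multiset_prod S (g := fun x y => y - x) fun i _ => by fun_prop
  set q : ℂ → ℂ := (fun y => 1 + F y) /
    ((fun y => (Λ.map fun x => y - x).prod) / (fun y => (Δ.map fun x => y - x).prod)) with hq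
  have hmer' : ∀ z ∈ C.region, MeromorphicAt (fun y => 1 + F y) z := fun z hz =>
    (MeromorphicAt.const 1 z).add (hmer z hz)
  have hrat : ∀ z, MeromorphicAt
      ((fun y => (Λ.map fun x => y - x).prod) / (fun y => (Δ.map fun x => y - x).prod)) z :=
    fun z => (hpoly Λ z).meromorphicAt.div (hpoly Δ z).meromorphicAt
  have hqmer : MeromorphicOn q C.region := fun z hz => (hmer' z hz).div (hrat z)
  have hqord : ∀ z ∈ C.region, meromorphicOrderAt q z = 0 := by
    intro z hz
    rw [hq, meromorphicOrderAt_div (hmer' z hz) (hrat z),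
      meromorphicOrderAt_div (hpoly Λ z).meromorphicAt (hpoly Δ z).meromorphicAt,
      meromorphicOrderAt_prod_sub, meromorphicOrderAt_prod_sub, hord z hz]
    norm_cast
    simp
  set w := toMeromorphicNFOn q C.region with hw
  have hwnf := meromorphicNFOn_toMeromorphicNFOn q C.region
  have hword : ∀ z ∈ C.region, meromorphicOrderAt w z = 0 := fun z hz => by
    rw [hw, meromorphicOrderAt_toMeromorphicNFOn hqmer hz, hqord z hz]
  have hwan : AnalyticOnNhd ℂ w C.region := fun z hz =>
    (hwnf hz).meromorphicOrderAt_nonneg_iff_analyticAt.1 (hword z hz).ge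
  have hnot : ∀ S : Multiset ℂ, (∀ x ∈ S, x ∈ C.inside) → ∀ z ∈ C.image,
      (S.map fun x => z - x).prod ≠ 0 := fun S hS z hz =>
    multiset_prod_ne_zero fun x hx h0 => (hS x hx).1 (by rwa [← sub_eq_zero.1 h0])
  refine ⟨w, hf, ?_, hwan, fun z hz => (hwnf hz).meromorphicOrderAt_eq_zero_iff.1 (hword z hz),
    hΛ, hΔ, ?_⟩
  · intro z hz
    refine (meromorphicOrderAt_eq_zero_iff_ne_zero (f := fun y => 1 + f y)
      (analyticAt_const.add (hf z hz))).1 ?_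
    rw [meromorphicOrderAt_one_add_congr (hfF z hz), hord z (C.image_subset_region hz),
      Multiset.count_eq_zero_of_notMem fun h => (hΛ z h).1 hz,
      Multiset.count_eq_zero_of_notMem fun h => (hΔ z h).1 hz]
    rfl
  · intro z hz
    have hzr := C.image_subset_region hz
    have h1 : w =ᶠ[𝓝[≠] z] q := hqmer.toMeromorphicNFOn_eq_self_on_nhdsNE hzr
    have h2 := ((hpoly Λ z).continuousAt.eventually_ne (hnot Λ hΛ z hz)).filter_mono
      (nhdsWithin_le_nhds (s := {z}ᶜ))
    have h3 := ((hpoly Δ z).continuousAt.eventually_ne (hnot Δ hΔ z hz)).filter_mono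
      (nhdsWithin_le_nhds (s := {z}ᶜ))
    have h4 : ∀ᶠ y in 𝓝[≠] z,
        (1 + f y) * (Δ.map fun x => y - x).prod = (Λ.map fun x => y - x).prod * w y := by
      filter_upwards [h1, h2, h3, hfF z hz] with y hy1 hy2 hy3 hy4
      rw [hy1, hy4, hq]
      simp only [Pi.div_apply]
      field_simp
    exact (AnalyticAt.frequently_eq_iff_eventually_eq
      ((analyticAt_const.add (hf z hz)).mul (hpoly Δ z))
      ((hpoly Λ z).mul (hwan z hzr))).1 h4.frequently

/-- The multiset of the zeros of a meromorphic function on the closed region which has a single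
pole inside the contour, of order `n`, and neither zeros nor poles on the contour. -/
lemma exists_zeros {C : Contour} {v : ℂ → ℂ} {p : ℂ} {n : ℕ} (hv : MeromorphicOn v C.region)
    (hpole : meromorphicOrderAt v p = ((-(n : ℤ) : ℤ) : WithTop ℤ))
    (hinside : ∀ z ∈ C.inside, z ≠ p → 0 ≤ meromorphicOrderAt v z)
    (himage : ∀ z ∈ C.image, meromorphicOrderAt v z = 0) :
    ∃ Λ : Multiset ℂ, (∀ x ∈ Λ, x ∈ C.inside) ∧ ∀ z ∈ C.region, meromorphicOrderAt v z =
      ((Λ.count z - (Multiset.replicate n p).count z : ℤ) : WithTop ℤ) := by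
  classical
  have hbase := C.base_mem_image
  have htop : ∀ z ∈ C.region, meromorphicOrderAt v z ≠ ⊤ := fun z hz =>
    hv.meromorphicOrderAt_ne_top_of_isPreconnected C.isPreconnected_region
      (C.image_subset_region hbase) hz (by rw [himage _ hbase]; exact WithTop.zero_ne_top)
  set D := MeromorphicOn.divisor v C.region with hD
  have hcoe : ∀ z ∈ C.region, meromorphicOrderAt v z = (D z : WithTop ℤ) := fun z hz => by
    rw [hD, MeromorphicOn.divisor_apply hv hz, WithTop.coe_untop₀_of_ne_top (htop z hz)]
  have hfin : (Function.support fun z => (D z).toNat).Finite :=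
    (D.finiteSupport C.isCompact_region).subset fun z hz h0 => hz (by simp [h0])
  set Λ : Multiset ℂ := Finsupp.toMultiset (Finsupp.ofSupportFinite _ hfin)
  have hcount : ∀ z, Λ.count z = (D z).toNat := fun z => by
    rw [Finsupp.count_toMultiset]
    rfl
  refine ⟨Λ, ?_, ?_⟩
  · intro x hx
    have hpos := Multiset.count_pos.2 hx
    rw [hcount] at hpos
    have hxr : x ∈ C.region := by
      by_contra hxr
      have : D x = 0 := Function.locallyFinsuppWithin.apply_eq_zero_of_notMem D hxr
      simp [this] at hpos
    refine hxr.resolve_right fun hxC => ?_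
    have h1 := himage x hxC
    rw [hcoe x hxr] at h1
    have h2 : D x = 0 := by exact_mod_cast h1
    simp [h2] at hpos
  · intro z hz
    rw [hcoe z hz, hcount, Multiset.count_replicate]
    by_cases hzp : z = p
    · have h1 := hcoe z hz
      rw [hzp, hpole] at h1
      have h2 : D p = -n := by exact_mod_cast h1.symm
      rw [hzp, if_pos rfl, h2]
      simp
    · rw [if_neg (Ne.symm hzp)]
      have h1 : 0 ≤ meromorphicOrderAt v z := by
        rcases hz with hz | hz
        · exact hinside z hz hzp
        · exact (himage z hz).ge
      rw [hcoe z hz] at h1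
      have h2 : 0 ≤ D z := by exact_mod_cast h1
      simp [Int.toNat_of_nonneg h2]

/-! ### The driving term and the auxiliary function -/

/-- The argument of the logarithm in the driving function. -/
def driveArg (P : Params) (z : ℂ) : ℂ :=
  Complex.sinh (z - P.ν) / Complex.sinh (z + P.ν) *
    (Complex.sinh (z + P.ν + P.η) / Complex.sinh (z - P.ν + P.η))

/-- The function `exp (-ε₀ / T)` as a power of a quotient of hyperbolic functions. The two agree
where the argument of the logarithm in `ε₀` is not `0`. -/
def drive (P : Params) (z : ℂ) : ℂ := Complex.exp (-P.α) * driveArg P z ^ (P.N / 2)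

section Drive

variable {P : Params} {C : Contour}

lemma Params.two_mul_half (P : Params) : 2 * (P.N / 2) = P.N := Nat.two_mul_div_two_of_even P.N_even

lemma Params.half_pos (P : Params) : 0 < P.N / 2 := by
  have h1 := P.two_mul_half
  have h2 := P.N_pos
  omega

lemma exp_neg_ε₀_div {z : ℂ} (hz : driveArg P z ≠ 0) :
    Complex.exp (-ε₀ P z / P.T) = drive P z := by
  have hT : (P.T : ℂ) ≠ 0 := Complex.ofReal_ne_zero.2 P.T_pos.ne'
  have hN : (P.N : ℂ) = 2 * (P.N / 2 : ℕ) := by exact_mod_cast P.two_mul_half.symm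
  have h1 : -ε₀ P z / P.T = -P.α + (P.N / 2 : ℕ) * Complex.log (driveArg P z) := by
    rw [ε₀, hN, Params.α, driveArg]
    field_simp
    ring
  rw [h1, Complex.exp_add, Complex.exp_nat_mul, Complex.exp_log hz, drive]

open Classical in
lemma meromorphicOrderAt_sinh_add (c z : ℂ) :
    meromorphicOrderAt (fun y => Complex.sinh (y + c)) z =
      ((if Complex.sinh (z + c) = 0 then 1 else 0 : ℤ) : WithTop ℤ) := by
  have han : AnalyticAt ℂ (fun y => Complex.sinh (y + c)) z := by fun_prop
  split_ifs with h
  · have hd : HasDerivAt (fun y => Complex.sinh (y + c)) (Complex.cosh (z + c)) z := by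
      simpa using ((hasDerivAt_id z).add_const c).csinh
    have hne : deriv (fun y => Complex.sinh (y + c)) z ≠ 0 := by
      rw [hd.deriv]
      intro h0
      have := Complex.cosh_sq_sub_sinh_sq (z + c)
      rw [h, h0] at this
      norm_num at this
    have h1 := han.analyticOrderAt_sub_eq_one_of_deriv_ne_zero hne
    simp only [h, sub_zero] at h1
    rw [han.meromorphicOrderAt_eq, h1]
    rfl
  · exact (meromorphicOrderAt_eq_zero_iff_ne_zero han).2 h

lemma meromorphicAt_driveArg (z : ℂ) : MeromorphicAt (driveArg P) z := by
  unfold driveArg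
  fun_prop

lemma meromorphicAt_drive (z : ℂ) : MeromorphicAt (drive P) z :=
  (MeromorphicAt.const _ z).mul ((meromorphicAt_driveArg z).pow _)

open Classical in
/-- The order of the zero or pole of `drive`, per factor, expressed by the zeros of the four
hyperbolic sines. -/
def driveOrder (P : Params) (z : ℂ) : ℤ :=
  (if Complex.sinh (z - P.ν) = 0 then 1 else 0) - (if Complex.sinh (z + P.ν) = 0 then 1 else 0) +
  ((if Complex.sinh (z + P.ν + P.η) = 0 then 1 else 0) -
    (if Complex.sinh (z - P.ν + P.η) = 0 then 1 else 0))

lemma meromorphicOrderAt_driveArg (z : ℂ) :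
    meromorphicOrderAt (driveArg P) z = (driveOrder P z : WithTop ℤ) := by
  have h1 := meromorphicOrderAt_sinh_add (-P.ν) z
  have h2 := meromorphicOrderAt_sinh_add P.ν z
  have h3 := meromorphicOrderAt_sinh_add (P.ν + P.η) z
  have h4 := meromorphicOrderAt_sinh_add (-P.ν + P.η) z
  have hm : ∀ c, MeromorphicAt (fun y => Complex.sinh (y + c)) z := fun c => by fun_prop
  have heq : driveArg P = (fun y => Complex.sinh (y + -P.ν)) / (fun y => Complex.sinh (y + P.ν)) *
      ((fun y => Complex.sinh (y + (P.ν + P.η))) / (fun y => Complex.sinh (y + (-P.ν + P.η)))) := by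
    ext y
    simp only [driveArg, Pi.mul_apply, Pi.div_apply]
    ring_nf
  rw [heq, meromorphicOrderAt_mul ((hm _).div (hm _)) ((hm _).div (hm _)),
    meromorphicOrderAt_div (hm _) (hm _), meromorphicOrderAt_div (hm _) (hm _), h1, h2, h3, h4,
    driveOrder]
  simp only [← sub_eq_add_neg, ← add_assoc]
  norm_cast

lemma meromorphicOrderAt_drive (z : ℂ) :
    meromorphicOrderAt (drive P) z = (((P.N / 2 : ℕ) * driveOrder P z : ℤ) : WithTop ℤ) := by
  have h1 : meromorphicOrderAt (drive P) z = meromorphicOrderAt (driveArg P ^ (P.N / 2)) z :=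
    meromorphicOrderAt_mul_of_ne_zero (g := fun _ => Complex.exp (-P.α))
      (f := driveArg P ^ (P.N / 2)) analyticAt_const (Complex.exp_ne_zero _)
  rw [h1, meromorphicOrderAt_pow (meromorphicAt_driveArg z), meromorphicOrderAt_driveArg]
  push_cast
  rfl

lemma meromorphicOrderAt_exp_ε₀ (z : ℂ) :
    meromorphicOrderAt (fun z => Complex.exp (-ε₀ P z / P.T)) z =
      meromorphicOrderAt (drive P) z := by
  have h1 : meromorphicOrderAt (driveArg P) z ≠ ⊤ := by
    rw [meromorphicOrderAt_driveArg]
    exact WithTop.coe_ne_top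
  refine meromorphicOrderAt_congr ?_
  filter_upwards [(meromorphicOrderAt_ne_top_iff_eventually_ne_zero
    (meromorphicAt_driveArg z)).1 h1] with y hy
  exact exp_neg_ε₀_div hy

lemma sinh_add_η_ne_zero {y : ℂ} (h : Complex.sinh y = 0) : Complex.sinh (y + P.η) ≠ 0 := by
  intro h0
  rw [Complex.sinh_add, h, zero_mul, zero_add] at h0
  have h1 := Complex.cosh_sq_sub_sinh_sq y
  rcases mul_eq_zero.1 h0 with h2 | h2
  · rw [h, h2] at h1
    norm_num at h1
  · exact P.sinh_η_ne_zero h2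

/-- The position of the zeros and poles of the driving term relative to a contour with shifts
outside. -/
structure DriveRegular (P : Params) (C : Contour) : Prop where
  encircles : -P.ν ∈ C.inside
  shifts : ShiftsOutside P C
  sinh_sub_add : ∀ z ∈ C.region, Complex.sinh (z - P.ν + P.η) ≠ 0
  sinh_add : ∀ z ∈ C.region, z ≠ -P.ν → Complex.sinh (z + P.ν) ≠ 0
  sinh_sub : ∀ z ∈ C.image, Complex.sinh (z - P.ν) ≠ 0

lemma ShiftsOutside.sinh_add_ν_ne_zero (hS : ShiftsOutside P C) (hν : -P.ν ∈ C.inside) {z : ℂ}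
    (hz : z ∈ C.region) :
    Complex.sinh (z + P.ν + P.η) ≠ 0 ∧ Complex.sinh (z + P.ν - P.η) ≠ 0 := by
  have := hS.sinh_ne_zero hz (C.inside_subset_region hν)
  rw [sub_neg_eq_add] at this
  exact this.symm

/-- The conditions on the orders of the driving term decide which of the hyperbolic sines vanish:
a cancellation between numerator and denominator would change the order at `-ν`. -/
lemma driveRegular_of_orders (hν : -P.ν ∈ C.inside) (hS : ShiftsOutside P C)
    (hpole : meromorphicOrderAt (drive P) (-P.ν) = -((P.N / 2 : ℕ) : ℤ))
    (hother : ∀ z ∈ C.inside, z ≠ -P.ν → 0 ≤ meromorphicOrderAt (drive P) z)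
    (himage : ∀ z ∈ C.image, meromorphicOrderAt (drive P) z = 0) : DriveRegular P C := by
  have hn : (0 : ℤ) < (P.N / 2 : ℕ) := by exact_mod_cast P.half_pos
  have h0 : driveOrder P (-P.ν) = -1 := by
    rw [meromorphicOrderAt_drive] at hpole
    have h1 : ((P.N / 2 : ℕ) : ℤ) * driveOrder P (-P.ν) = -((P.N / 2 : ℕ) : ℤ) := by
      exact_mod_cast hpole
    nlinarith
  have hη : ∀ z ∈ C.region, Complex.sinh (z + P.ν + P.η) ≠ 0 := fun z hz =>
    (hS.sinh_add_ν_ne_zero hν hz).1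
  have hνν : Complex.sinh (-P.ν - P.ν) ≠ 0 ∧ Complex.sinh (-P.ν - P.ν + P.η) ≠ 0 := by
    rw [driveOrder, if_neg (hη _ (C.inside_subset_region hν)),
      if_pos (show Complex.sinh (-P.ν + P.ν) = 0 by rw [neg_add_cancel, Complex.sinh_zero])] at h0
    by_cases h1 : Complex.sinh (-P.ν - P.ν) = 0
    · rw [if_pos h1, if_neg (sinh_add_η_ne_zero h1)] at h0
      norm_num at h0
    · refine ⟨h1, fun h2 => ?_⟩
      rw [if_neg h1, if_pos h2] at h0
      norm_num at h0
  -- if `sinh (z - ν)` and `sinh (z + ν)` both vanish, then so does `sinh (2ν)`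
  have hboth : ∀ z, Complex.sinh (z - P.ν) = 0 → Complex.sinh (z + P.ν) ≠ 0 := by
    intro z h1 h2
    refine hνν.1 ?_
    rw [show -P.ν - P.ν = (z - P.ν) - (z + P.ν) by ring, Complex.sinh_sub, h1, h2]
    ring
  have hord : ∀ z ∈ C.region, z ≠ -P.ν → 0 ≤ driveOrder P z := by
    intro z hz hne
    have h1 : 0 ≤ meromorphicOrderAt (drive P) z := by
      rcases hz with hz | hz
      · exact hother z hz hne
      · exact (himage z hz).ge
    rw [meromorphicOrderAt_drive] at h1
    have h2 : 0 ≤ ((P.N / 2 : ℕ) : ℤ) * driveOrder P z := by exact_mod_cast h1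
    exact nonneg_of_mul_nonneg_right h2 hn
  have hposs : ∀ z ∈ C.region, z ≠ -P.ν →
      Complex.sinh (z + P.ν) ≠ 0 ∧ Complex.sinh (z - P.ν + P.η) ≠ 0 := by
    intro z hz hne
    have h1 := hord z hz hne
    rw [driveOrder, if_neg (hη z hz)] at h1
    by_cases h2 : Complex.sinh (z - P.ν) = 0
    · exact ⟨hboth z h2, sinh_add_η_ne_zero h2⟩
    · rw [if_neg h2] at h1
      constructor
      · intro h3
        rw [if_pos h3] at h1
        split_ifs at h1 <;> norm_num at h1
      · intro h3
        rw [if_pos h3] at h1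
        split_ifs at h1 <;> norm_num at h1
  have hneC : ∀ z ∈ C.image, z ≠ -P.ν := fun z hz h => hν.1 (h ▸ hz)
  refine ⟨hν, hS, fun z hz => ?_, fun z hz hne => (hposs z hz hne).1, fun z hz h => ?_⟩
  · by_cases hne : z = -P.ν
    · rw [hne]
      exact hνν.2
    · exact (hposs z hz hne).2
  · have hzr := C.image_subset_region hz
    obtain ⟨h1, h2⟩ := hposs z hzr (hneC z hz)
    have h3 := himage z hz
    rw [meromorphicOrderAt_drive, driveOrder, if_pos h, if_neg h1, if_neg h2,
      if_neg (hη z hzr)] at h3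
    have h4 : ((P.N / 2 : ℕ) : ℤ) * (1 - 0 + (0 - 0)) = 0 := by exact_mod_cast h3
    omega

lemma IsDrivingContour.driveRegular (h : IsDrivingContour P C) : DriveRegular P C := by
  have h1 := h.order_pole
  have h2 := h.no_other_pole
  have h3 := h.on_contour
  simp only [meromorphicOrderAt_exp_ε₀] at h1 h2 h3
  exact driveRegular_of_orders h.encircles h.shifts h1 h2 h3

lemma DriveRegular.driveArg_ne_zero (h : DriveRegular P C) {z : ℂ} (hz : z ∈ C.image) :
    driveArg P z ≠ 0 := by
  have hzr := C.image_subset_region hz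
  have hne : z ≠ -P.ν := fun h0 => h.encircles.1 (h0 ▸ hz)
  exact mul_ne_zero (div_ne_zero (h.sinh_sub z hz) (h.sinh_add z hzr hne))
    (div_ne_zero (h.shifts.sinh_add_ν_ne_zero h.encircles hzr).1 (h.sinh_sub_add z hzr))

lemma DriveRegular.analyticAt_drive (h : DriveRegular P C) {z : ℂ} (hz : z ∈ C.region)
    (hne : z ≠ -P.ν) : AnalyticAt ℂ (drive P) z := by
  have h1 := h.sinh_add z hz hne
  have h2 := h.sinh_sub_add z hz
  have h3 : AnalyticAt ℂ (driveArg P) z :=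
    .mul (.div (by fun_prop) (by fun_prop) h1) (.div (by fun_prop) (by fun_prop) h2)
  exact analyticAt_const.mul (h3.pow _)

/-- The vacuum part of the auxiliary function is the driving term divided by the scattering factors
of the `N / 2`-fold pole at `-ν`, so that the auxiliary function is the driving term times a
product of scattering factors of Bethe roots and of this pole. -/
lemma aux_eq_drive_mul {Λ : Multiset ℂ} {x z : ℂ} (h1 : Complex.sinh (z + P.ν + P.η) ≠ 0) :
    aux P Λ z = drive P z * scatterProd P x 0 Λ (Multiset.replicate (P.N / 2) (-P.ν)) z := by
  have hQ : Q Λ (z + P.η) / Q Λ (z - P.η) = (Λ.map fun c => scatter P c z).prod := by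
    simp only [Q, scatter, Multiset.prod_map_div]
    congr 2
    · exact Multiset.map_congr rfl fun c _ => by rw [add_sub_right_comm]
    · exact Multiset.map_congr rfl fun c _ => by rw [sub_right_comm]
  have hb : P.b (-P.ν - z) = Complex.sinh (z + P.ν) / Complex.sinh (z + P.ν - P.η) := by
    rw [Params.b, show -P.ν - z = -(z + P.ν) by ring, Complex.sinh_neg,
      show -(z + P.ν) + P.η = -(z + P.ν - P.η) by ring, Complex.sinh_neg, neg_div_neg_eq]
  have hexp : Complex.exp (-P.α) = Complex.exp (-P.α / 2) / Complex.exp (P.α / 2) := by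
    rw [← Complex.exp_sub]
    congr 1
    ring
  have hdiv : aux P Λ z = P.d z / P.a z * (Q Λ (z + P.η) / Q Λ (z - P.η)) := by
    rw [aux, mul_div_mul_comm]
  rw [hdiv, hQ, Params.d, Params.a, hb, Params.b, drive, driveArg, scatterProd, zpow_zero, one_mul,
    Multiset.map_replicate, Multiset.prod_replicate, scatter, sub_neg_eq_add, hexp]
  generalize Complex.exp (-P.α / 2) = e₁
  generalize Complex.exp (P.α / 2) = e₂
  simp only [div_eq_mul_inv, mul_pow, mul_inv, inv_pow, inv_inv]
  have h3 := mul_inv_cancel₀ (pow_ne_zero (P.N / 2) h1)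
  linear_combination (-(e₁ * e₂⁻¹ *
    Complex.sinh (z - P.ν) ^ (P.N / 2) * (Complex.sinh (z + P.ν) ^ (P.N / 2))⁻¹ *
    (Complex.sinh (z - P.ν + P.η) ^ (P.N / 2))⁻¹ * Complex.sinh (z + P.ν - P.η) ^ (P.N / 2) *
    (Multiset.map (fun c => scatter P c z) Λ).prod)) * h3

end Drive

section Correspondence

variable {P : Params} {C : Contour} {Λ : Multiset ℂ}

/-- The pole of the auxiliary function at `-ν`, with its multiplicity `N / 2`. -/
def poles (P : Params) : Multiset ℂ := Multiset.replicate (P.N / 2) (-P.ν)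

lemma mem_poles {x : ℂ} (hx : x ∈ poles P) : x = -P.ν := Multiset.eq_of_mem_replicate hx

lemma card_poles : (poles P).card = P.N / 2 := Multiset.card_replicate _ _

lemma count_poles_self : (poles P).count (-P.ν) = P.N / 2 := Multiset.count_replicate_self _ _

lemma count_poles_of_ne {z : ℂ} (hz : z ≠ -P.ν) : (poles P).count z = 0 :=
  Multiset.count_eq_zero_of_notMem fun h => hz (mem_poles h)

lemma meromorphicOn_aux (P : Params) (Λ : Multiset ℂ) : MeromorphicOn (aux P Λ) univ := by
  intro z _
  have hQ : ∀ c : ℂ, MeromorphicAt (fun y => Q Λ (y + c)) z := fun c =>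
    (analyticAt_multiset_prod Λ (g := fun x y => Complex.sinh (y + c - x))
      fun i _ => by fun_prop).meromorphicAt
  have hb : ∀ g : ℂ → ℂ, AnalyticAt ℂ g z → MeromorphicAt (fun y => P.b (g y)) z := by
    intro g hg
    exact MeromorphicAt.div (f := fun y => Complex.sinh (g y))
      (g := fun y => Complex.sinh (g y + P.η)) (by fun_prop) (by fun_prop)
  have hd : MeromorphicAt P.d z := (MeromorphicAt.const _ z).mul ((hb _ (by fun_prop)).pow _)
  have ha : MeromorphicAt P.a z := (MeromorphicAt.const _ z).mul ((hb _ (by fun_prop)).pow _)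
  exact (hd.mul (hQ P.η)).div (ha.mul (hQ (-P.η)))

lemma meromorphicAt_one_add_aux (z : ℂ) : MeromorphicAt (fun y => 1 + aux P Λ y) z :=
  (MeromorphicAt.const 1 z).add (meromorphicOn_aux P Λ z (mem_univ z))

lemma analyticAt_scatterProd {x : ℂ} {s : ℤ} {Δ : Multiset ℂ} {z : ℂ} (hz : z ∈ regularSet P C)
    (hx : x ∈ C.region) (hΛ : ∀ c ∈ Λ, c ∈ C.region) (hΔ : ∀ c ∈ Δ, c ∈ C.region) :
    AnalyticAt ℂ (scatterProd P x s Λ Δ) z :=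
  DifferentiableOn.analyticAt (s := regularSet P C) (fun _ hy =>
    (logDeriv_scatterProd hy hx hΛ hΔ).1.differentiableWithinAt) (isOpen_regularSet.mem_nhds hz)

/-- On the closed region the auxiliary function differs from the driving term by a holomorphic
function without zeros. -/
lemma aux_eventuallyEq (hν : -P.ν ∈ C.inside) (hS : ShiftsOutside P C) {z : ℂ}
    (hz : z ∈ C.region) (x : ℂ) :
    aux P Λ =ᶠ[𝓝 z] fun y => drive P y * scatterProd P x 0 Λ (poles P) y := by
  filter_upwards [(isOpen_regularSet (P := P) (C := C)).mem_nhds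
    (hS.region_subset_regularSet hz)] with y hy
  have := (hy _ (C.inside_subset_region hν)).2
  rw [sub_neg_eq_add] at this
  exact aux_eq_drive_mul this

lemma poles_region (hν : -P.ν ∈ C.inside) : ∀ x ∈ poles P, x ∈ C.region := fun _ hx =>
  C.inside_subset_region (mem_poles hx ▸ hν)

lemma meromorphicOrderAt_aux (hν : -P.ν ∈ C.inside) (hS : ShiftsOutside P C)
    (hΛ : ∀ x ∈ Λ, x ∈ C.inside) {z : ℂ} (hz : z ∈ C.region) :
    meromorphicOrderAt (aux P Λ) z = meromorphicOrderAt (drive P) z := by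
  have hzr := hS.region_subset_regularSet hz
  have hx := C.image_subset_region C.base_mem_image
  have hΛ' := fun x hx => C.inside_subset_region (hΛ x hx)
  rw [meromorphicOrderAt_congr ((aux_eventuallyEq hν hS hz C.base).filter_mono nhdsWithin_le_nhds),
    ← meromorphicOrderAt_mul_of_ne_zero (f := drive P)
      (analyticAt_scatterProd (s := 0) hzr hx hΛ' (poles_region hν))
      (scatterProd_ne_zero hzr hx hΛ' (poles_region hν))]
  exact meromorphicOrderAt_congr (Eventually.of_forall fun y => mul_comm _ _)

lemma DriveRegular.analyticAt_aux (h : DriveRegular P C) (hΛ : ∀ x ∈ Λ, x ∈ C.inside) {z : ℂ}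
    (hz : z ∈ C.region) (hne : z ≠ -P.ν) : AnalyticAt ℂ (aux P Λ) z :=
  ((h.analyticAt_drive hz hne).mul (analyticAt_scatterProd (h.shifts.region_subset_regularSet hz)
    (C.image_subset_region C.base_mem_image) (fun x hx => C.inside_subset_region (hΛ x hx))
    (poles_region h.encircles))).congr (aux_eventuallyEq h.encircles h.shifts hz C.base).symm

lemma ne_neg_ν_of_mem_image (hν : -P.ν ∈ C.inside) {z : ℂ} (hz : z ∈ C.image) : z ≠ -P.ν :=
  fun h => hν.1 (h ▸ hz)

/-! ### From Bethe roots to the nonlinear integral equation -/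

lemma IsBetheContour.meromorphicOrderAt_drive (h : IsBetheContour P Λ C) {z : ℂ}
    (hz : z ∈ C.region) : meromorphicOrderAt (drive P) z = meromorphicOrderAt (aux P Λ) z :=
  (meromorphicOrderAt_aux h.encircles h.shifts h.encircles_roots hz).symm

lemma IsBetheContour.isDrivingContour (h : IsBetheContour P Λ C) : IsDrivingContour P C := by
  have hpos : (0 : ℤ) < (P.N / 2 : ℕ) := by exact_mod_cast P.half_pos
  refine ⟨h.encircles, ?_, ?_, ?_, h.shifts⟩
  · rw [meromorphicOrderAt_exp_ε₀, h.meromorphicOrderAt_drive (C.inside_subset_region h.encircles),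
      meromorphicOrderAt_of_one_add_neg, h.order_pole]
    rw [h.order_pole]
    have : (-((P.N / 2 : ℕ) : ℤ)) < 0 := by omega
    exact_mod_cast this
  · intro z hz hne
    rw [meromorphicOrderAt_exp_ε₀, h.meromorphicOrderAt_drive (C.inside_subset_region hz)]
    refine meromorphicOrderAt_nonneg_of_one_add ?_
    rw [h.order_inside z hz hne]
    exact_mod_cast Nat.zero_le _
  · intro z hz
    rw [meromorphicOrderAt_exp_ε₀, h.meromorphicOrderAt_drive (C.image_subset_region hz)]
    exact (h.on_contour z hz).2

/-- A Bethe root is never at `-ν`, where the denominator of the auxiliary function vanishes. -/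
lemma IsBetheSolution.neg_ν_notMem (h : IsBetheSolution P Λ) : -P.ν ∉ Λ := by
  intro hmem
  have h1 := h _ hmem
  have h2 : P.a (-P.ν) = 0 := by
    rw [Params.a, sub_self, Params.b, Complex.sinh_zero, zero_div,
      zero_pow P.half_pos.ne', mul_zero]
  rw [h2, zero_mul, div_zero] at h1
  norm_num at h1

lemma IsBetheContour.meromorphicOrderAt_eq (h : IsBetheContour P Λ C) (hν : -P.ν ∉ Λ) {z : ℂ}
    (hz : z ∈ C.region) : meromorphicOrderAt (fun y => 1 + aux P Λ y) z =
      ((Λ.count z - (poles P).count z : ℤ) : WithTop ℤ) := by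
  by_cases hne : z = -P.ν
  · rw [hne, h.order_pole, Multiset.count_eq_zero_of_notMem hν, count_poles_self, Nat.cast_zero,
      zero_sub]
    rfl
  · rw [count_poles_of_ne hne]
    rcases hz with hz | hz
    · rw [h.order_inside z hz hne]
      simp
    · rw [(h.on_contour z hz).1,
        Multiset.count_eq_zero_of_notMem fun hmem => (h.encircles_roots z hmem).1 hz]
      simp

/-- The exponential of the right hand side of the nonlinear integral equation. -/
lemma exp_nlie {f : ℂ → ℂ} {s : ℤ} (h : DriveRegular P C) {z : ℂ} (hz : z ∈ C.image) :
    Complex.exp (-(s : ℂ) * Complex.log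
        (Complex.sinh (z - C.base + P.η) / Complex.sinh (z - C.base - P.η))
      - ε₀ P z / P.T
      - (2 * Real.pi * Complex.I)⁻¹ *
        ∫ t in (0 : ℝ)..1, K P (z - C.toFun t) * C.logOneAdd f t * deriv C.toFun t) =
    drive P z * scatter P C.base z ^ (-s) *
      Complex.exp (-((2 * Real.pi * Complex.I)⁻¹ * convolution P C f z)) := by
  have hne : scatter P C.base z ≠ 0 :=
    scatter_ne_zero (h.shifts.region_subset_regularSet (C.image_subset_region hz))
      (C.image_subset_region C.base_mem_image)
  have h1 : Complex.exp (-(s : ℂ) * Complex.log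
      (Complex.sinh (z - C.base + P.η) / Complex.sinh (z - C.base - P.η))) =
      scatter P C.base z ^ (-s) := by
    rw [← Int.cast_neg, Complex.exp_int_mul]
    exact congrArg (· ^ (-s)) (Complex.exp_log hne)
  rw [sub_eq_add_neg _ (_ * _), Complex.exp_add, sub_eq_add_neg, Complex.exp_add, h1, ← neg_div,
    exp_neg_ε₀_div (h.driveArg_ne_zero hz), mul_comm (drive P z)]
  rfl

theorem isSolution_aux (hB : IsBetheSolution P Λ) (h : IsBetheContour P Λ C) :
    IsSolution P C (((P.N / 2 : ℕ) : ℤ) - (Λ.card : ℤ)) (aux P Λ) := by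
  have hreg := h.isDrivingContour.driveRegular
  have han : AnalyticOnNhd ℂ (aux P Λ) C.image := fun z hz =>
    hreg.analyticAt_aux h.encircles_roots (C.image_subset_region hz)
      (ne_neg_ν_of_mem_image h.encircles hz)
  obtain ⟨w, hw⟩ := exists_hasFactorization (F := aux P Λ)
    ((meromorphicOn_aux P Λ).mono_set (subset_univ _))
    (fun z hz => h.meromorphicOrderAt_eq hB.neg_ν_notMem hz) h.encircles_roots
    (fun x hx => mem_poles hx ▸ h.encircles) han fun z _ => EventuallyEq.rfl
  refine ⟨han, hw.ne_zero, ?_, ?_⟩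
  · rw [hw.monodromy_iff, card_poles]
  · refine ⟨fun z => -(((((P.N / 2 : ℕ) : ℤ) - (Λ.card : ℤ) : ℤ)) : ℂ) * Complex.log
        (Complex.sinh (z - C.base + P.η) / Complex.sinh (z - C.base - P.η))
      - ε₀ P z / P.T
      - (2 * Real.pi * Complex.I)⁻¹ *
        ∫ t in (0 : ℝ)..1, K P (z - C.toFun t) * C.logOneAdd (aux P Λ) t * deriv C.toFun t,
      fun z hz => ?_, fun z hz => rfl⟩
    have hzr := C.image_subset_region hz
    have hne : scatter P C.base z ≠ 0 :=
      scatter_ne_zero (hreg.shifts.region_subset_regularSet hzr)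
        (C.image_subset_region C.base_mem_image)
    rw [exp_nlie hreg hz, (hw.exp_convolution hreg.shifts hzr).self_of_nhds, card_poles,
      (aux_eventuallyEq h.encircles h.shifts hzr C.base).eq_of_nhds, scatterProd, scatterProd,
      zpow_zero, one_mul, zpow_neg]
    field_simp

/-! ### From the nonlinear integral equation to Bethe roots -/

/-- The meromorphic continuation, given by the nonlinear integral equation, of a solution from the
contour to the region inside. -/
def continuation (P : Params) (C : Contour) (s : ℤ) (f : ℂ → ℂ) (z : ℂ) : ℂ :=
  drive P z * (scatter P C.base z ^ (-s) *
    Complex.exp (-((2 * Real.pi * Complex.I)⁻¹ * convolution P C f z)))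

lemma IsSolution.analyticAt_continuation_factor {s : ℤ} {f : ℂ → ℂ} (hf : IsSolution P C s f)
    {z : ℂ} (hz : z ∈ regularSet P C) : AnalyticAt ℂ (fun y => scatter P C.base y ^ (-s) *
      Complex.exp (-((2 * Real.pi * Complex.I)⁻¹ * convolution P C f y))) z := by
  have hx := C.image_subset_region C.base_mem_image
  have h1 : AnalyticAt ℂ (convolution P C f) z :=
    DifferentiableOn.analyticAt (s := regularSet P C) (fun y hy =>
      (hasDerivAt_convolution_integral (Contour.continuousOn_logOneAdd hf.analytic hf.ne_zero)
        hy).2.differentiableAt.differentiableWithinAt) (isOpen_regularSet.mem_nhds hz)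
  exact ((analyticAt_scatter (hz _ hx).1).zpow (scatter_ne_zero hz hx)).mul
    (analyticAt_const.mul h1).neg.cexp

/-- A solution coincides with its continuation near the contour, by the identity theorem: a contour
has no isolated points. -/
lemma IsSolution.eventuallyEq_continuation {s : ℤ} {f : ℂ → ℂ} (hf : IsSolution P C s f)
    (hreg : DriveRegular P C) {z : ℂ} (hz : z ∈ C.image) : f =ᶠ[𝓝 z] continuation P C s f := by
  have hzr := C.image_subset_region hz
  have hon : ∀ y ∈ C.image, f y = continuation P C s f y := by
    intro y hy
    obtain ⟨lnf, h1, h2⟩ := hf.nlie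
    rw [← h1 y hy, h2 y hy, exp_nlie hreg hy, continuation, mul_assoc]
  have hacc : AccPt z (𝓟 C.image) :=
    C.isPreconnected_image.preperfect_of_nontrivial C.nontrivial_image z hz
  refine (AnalyticAt.frequently_eq_iff_eventually_eq (hf.analytic z hz)
    ((hreg.analyticAt_drive hzr (ne_neg_ν_of_mem_image hreg.encircles hz)).mul
      (hf.analyticAt_continuation_factor (hreg.shifts.region_subset_regularSet hzr)))).1 ?_
  exact (accPt_iff_frequently_nhdsNE.1 hacc).mono fun y hy => hon y hy

theorem IsSolution.exists_betheSolution {s : ℤ} {f : ℂ → ℂ} (hf : IsSolution P C s f)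
    (hC : IsDrivingContour P C) :
    ∃ Λ : Multiset ℂ, IsBetheSolution P Λ ∧ IsBetheContour P Λ C ∧
      (Λ.card : ℤ) = ((P.N / 2 : ℕ) : ℤ) - s ∧ f =ᶠ[𝓝ˢ C.image] aux P Λ := by
  have hreg := hC.driveRegular
  have hν := hreg.encircles
  have hνr := C.inside_subset_region hν
  have hx := C.image_subset_region C.base_mem_image
  have hpos : (0 : ℤ) < (P.N / 2 : ℕ) := by exact_mod_cast P.half_pos
  have hsub := hreg.shifts.region_subset_regularSet
  set F := continuation P C s f with hF
  -- the continuation has the same zeros and poles as the driving term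
  have hfac := fun z (hz : z ∈ C.region) => hf.analyticAt_continuation_factor (hsub hz)
  have hfacne : ∀ z ∈ C.region, scatter P C.base z ^ (-s) *
      Complex.exp (-((2 * Real.pi * Complex.I)⁻¹ * convolution P C f z)) ≠ 0 := fun z hz =>
    mul_ne_zero (zpow_ne_zero _ (scatter_ne_zero (hsub hz) hx)) (Complex.exp_ne_zero _)
  have hFmer : MeromorphicOn F C.region := fun z hz =>
    (meromorphicAt_drive z).mul (hfac z hz).meromorphicAt
  have hFord : ∀ z ∈ C.region, meromorphicOrderAt F z =
      meromorphicOrderAt (fun z => Complex.exp (-ε₀ P z / P.T)) z := by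
    intro z hz
    rw [meromorphicOrderAt_exp_ε₀,
      ← meromorphicOrderAt_mul_of_ne_zero (f := drive P) (hfac z hz) (hfacne z hz)]
    exact meromorphicOrderAt_congr (Eventually.of_forall fun y => mul_comm _ _)
  have hfF := fun z (hz : z ∈ C.image) =>
    (hf.eventuallyEq_continuation hreg hz).filter_mono (nhdsWithin_le_nhds (s := {z}ᶜ))
  have hpole : meromorphicOrderAt (fun y => 1 + F y) (-P.ν) =
      ((-((P.N / 2 : ℕ) : ℤ) : ℤ) : WithTop ℤ) := by
    have h1 : meromorphicOrderAt F (-P.ν) = ((-((P.N / 2 : ℕ) : ℤ) : ℤ) : WithTop ℤ) := by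
      rw [hFord _ hνr, hC.order_pole]
      rfl
    rw [meromorphicOrderAt_one_add_of_neg, h1]
    rw [h1]
    have : (-((P.N / 2 : ℕ) : ℤ)) < 0 := by omega
    exact_mod_cast this
  have hin : ∀ z ∈ C.inside, z ≠ -P.ν → 0 ≤ meromorphicOrderAt (fun y => 1 + F y) z :=
    fun z hz hne => meromorphicOrderAt_one_add_nonneg (by
      rw [hFord z (C.inside_subset_region hz)]
      exact hC.no_other_pole z hz hne)
  have him : ∀ z ∈ C.image, meromorphicOrderAt (fun y => 1 + F y) z = 0 := fun z hz => by
    rw [← meromorphicOrderAt_one_add_congr (hfF z hz)]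
    exact (meromorphicOrderAt_eq_zero_iff_ne_zero (f := fun y => 1 + f y)
      (analyticAt_const.add (hf.analytic z hz))).2 (hf.ne_zero z hz)
  obtain ⟨Λ, hΛ, hord⟩ := exists_zeros (C := C) (v := fun y => 1 + F y) (p := -P.ν) (n := P.N / 2)
    (fun z hz => (MeromorphicAt.const 1 z).add (hFmer z hz)) hpole hin him
  have hΔ : ∀ x ∈ poles P, x ∈ C.inside := fun x hx => mem_poles hx ▸ hν
  obtain ⟨w, hw⟩ := exists_hasFactorization hFmer hord hΛ hΔ hf.analytic hfF
  have hs : s = ((P.N / 2 : ℕ) : ℤ) - (Λ.card : ℤ) := by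
    have := (hw.monodromy_iff s).1 hf.monodromy
    rwa [Multiset.card_replicate] at this
  -- hence the continuation is an auxiliary function
  have hFaux : ∀ z ∈ C.region, F =ᶠ[𝓝 z] aux P Λ := by
    intro z hz
    have h1 := hw.exp_convolution (P := P) hreg.shifts hz
    filter_upwards [h1, aux_eventuallyEq hν hreg.shifts hz C.base,
      isOpen_regularSet.mem_nhds (hsub hz)] with y hy1 hy2 hy3
    have hne := scatter_ne_zero hy3 hx
    rw [hy2, hF, continuation, hy1, Multiset.card_replicate, ← hs, scatterProd, scatterProd,
      zpow_zero, one_mul, zpow_neg, poles]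
    field_simp
  have hordaux : ∀ z ∈ C.region, meromorphicOrderAt (fun y => 1 + aux P Λ y) z =
      ((Λ.count z - (poles P).count z : ℤ) : WithTop ℤ) := fun z hz =>
    (meromorphicOrderAt_one_add_congr
      ((hFaux z hz).symm.filter_mono nhdsWithin_le_nhds)).trans (hord z hz)
  have hνΛ : Λ.count (-P.ν) = 0 := by
    have h1 := hord _ hνr
    rw [hpole, Multiset.count_replicate_self] at h1
    have h2 : -((P.N / 2 : ℕ) : ℤ) = Λ.count (-P.ν) - (P.N / 2 : ℕ) := by exact_mod_cast h1
    omega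
  refine ⟨Λ, ?_, ⟨hν, ?_, hΛ, ?_, ?_, hreg.shifts⟩, by omega, ?_⟩
  · intro x hxΛ
    have hxr := C.inside_subset_region (hΛ x hxΛ)
    have hne : x ≠ -P.ν := by
      rintro rfl
      exact Multiset.count_eq_zero.1 hνΛ hxΛ
    have h1 := hordaux x hxr
    rw [count_poles_of_ne hne] at h1
    have hpos' := Multiset.count_pos.2 hxΛ
    have han : AnalyticAt ℂ (fun y => 1 + aux P Λ y) x :=
      analyticAt_const.add (hreg.analyticAt_aux hΛ hxr hne)
    have h2 : 1 + aux P Λ x = 0 := by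
      by_contra h3
      rw [(meromorphicOrderAt_eq_zero_iff_ne_zero han).2 h3] at h1
      have h4 : (0 : ℤ) = Λ.count x - (0 : ℕ) := by exact_mod_cast h1
      omega
    exact eq_neg_of_add_eq_zero_right h2
  · rw [hordaux _ hνr, hνΛ, count_poles_self, Nat.cast_zero, zero_sub]
    rfl
  · intro z hz hne
    rw [hordaux z (C.inside_subset_region hz), count_poles_of_ne hne]
    simp
  · intro z hz
    have hzr := C.image_subset_region hz
    refine ⟨?_, ?_⟩
    · rw [← him z hz]
      exact meromorphicOrderAt_one_add_congr ((hFaux z hzr).symm.filter_mono nhdsWithin_le_nhds)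
    · rw [meromorphicOrderAt_aux hν hreg.shifts hΛ hzr, ← meromorphicOrderAt_exp_ε₀]
      exact hC.on_contour z hz
  · refine eventually_nhdsSet_iff_forall.2 fun z hz => ?_
    exact (hf.eventuallyEq_continuation hreg hz).trans (hFaux z (C.image_subset_region hz))

/-- Solutions of the Bethe equations which share a contour are determined by their auxiliary
function near one point. -/
lemma eq_of_aux_eventuallyEq {Λ₁ Λ₂ : Multiset ℂ} (h₁ : IsBetheSolution P Λ₁)
    (h₂ : IsBetheSolution P Λ₂) (hC₁ : IsBetheContour P Λ₁ C) (hC₂ : IsBetheContour P Λ₂ C) {z₀ : ℂ}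
    (h : aux P Λ₁ =ᶠ[𝓝[≠] z₀] aux P Λ₂) : Λ₁ = Λ₂ := by
  classical
  ext z
  by_cases hz : z ∈ C.region
  · have h3 := meromorphicOrderAt_one_add_congr
      (eventuallyEq_nhdsNE_of_meromorphic (meromorphicOn_aux P Λ₁) (meromorphicOn_aux P Λ₂) h z)
    rw [hC₁.meromorphicOrderAt_eq h₁.neg_ν_notMem hz,
      hC₂.meromorphicOrderAt_eq h₂.neg_ν_notMem hz] at h3
    have h4 : (Λ₁.count z - (poles P).count z : ℤ) = Λ₂.count z - (poles P).count z := by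
      exact_mod_cast h3
    omega
  · rw [Multiset.count_eq_zero_of_notMem fun hm =>
        hz (C.inside_subset_region (hC₁.encircles_roots z hm)),
      Multiset.count_eq_zero_of_notMem fun hm =>
        hz (C.inside_subset_region (hC₂.encircles_roots z hm))]

theorem IsSolution.existsUnique_betheSolution {s : ℤ} {f : ℂ → ℂ} (hf : IsSolution P C s f)
    (hC : IsDrivingContour P C) :
    ∃! Λ : Multiset ℂ, IsBetheSolution P Λ ∧ IsBetheContour P Λ C ∧
      (Λ.card : ℤ) = ((P.N / 2 : ℕ) : ℤ) - s ∧ f =ᶠ[𝓝ˢ C.image] aux P Λ := by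
  obtain ⟨Λ, h1, h2, h3, h4⟩ := hf.exists_betheSolution hC
  refine ⟨Λ, ⟨h1, h2, h3, h4⟩, fun Λ' ⟨h1', h2', _, h4'⟩ => ?_⟩
  have hbase := C.base_mem_image
  have h5 := (eventually_nhdsSet_iff_forall.1 h4' _ hbase).and
    (eventually_nhdsSet_iff_forall.1 h4 _ hbase)
  exact eq_of_aux_eventuallyEq (z₀ := C.base) h1' h1 h2' h2
    ((h5.mono fun y hy => hy.1.symm.trans hy.2).filter_mono nhdsWithin_le_nhds)

end Correspondence

/-! ### Deformation of contours -/

section Perturbation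

variable {ψ : ℂ → ℂ}

lemma injective_add_of_lipschitz (hL : LipschitzWith (1 / 2) ψ) :
    Function.Injective fun z => z + ψ z := by
  intro x y hxy
  have h1 := hL.dist_le_mul x y
  have h2 : x - y = -(ψ x - ψ y) := by linear_combination hxy
  rw [dist_eq_norm, dist_eq_norm, h2, norm_neg] at h1
  have h3 : ‖ψ x - ψ y‖ = 0 := by
    have h4 : (((1 / 2 : NNReal)) : ℝ) = 1 / 2 := by norm_num
    rw [h4] at h1
    linarith [norm_nonneg (ψ x - ψ y)]
  rw [norm_eq_zero.1 h3, neg_zero] at h2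
  exact sub_eq_zero.1 h2

lemma surjective_add_of_lipschitz (hL : LipschitzWith (1 / 2) ψ) :
    Function.Surjective fun z => z + ψ z := by
  intro y
  have hc : ContractingWith (1 / 2) fun z => y - ψ z := by
    refine ⟨by rw [div_lt_one two_pos]; exact one_lt_two, ?_⟩
    refine LipschitzWith.of_dist_le_mul fun a b => ?_
    rw [dist_sub_left]
    exact hL.dist_le_mul a b
  obtain ⟨z, hz, -⟩ := hc.exists_fixedPoint 0 (edist_ne_top _ _)
  refine ⟨z, ?_⟩
  have h1 : y - ψ z = z := hz
  simp only
  linear_combination -h1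

/-- A perturbation of the identity by a contraction does not change winding numbers: the quotient
`(Ψ w - Ψ z) / (w - z)` stays in the disc of radius `1/2` about `1`, where the logarithm is
holomorphic. -/
lemma windingNumber_perturb (C : Contour) (hψ : ContDiff ℝ 1 ψ) (hL : LipschitzWith (1 / 2) ψ)
    (hg : PiecewiseC1 fun t => C.toFun t + ψ (C.toFun t)) {z : ℂ} (hz : z ∉ C.image) :
    windingNumber (fun t => C.toFun t + ψ (C.toFun t)) (z + ψ z) = windingNumber C.toFun z := by
  set g : ℝ → ℂ := fun t => C.toFun t + ψ (C.toFun t) with hgdef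
  have hne : ∀ t ∈ Icc (0 : ℝ) 1, C.toFun t - z ≠ 0 := fun t ht h0 =>
    hz (by rw [← sub_eq_zero.1 h0]; exact Contour.mem_image ht)
  have hne' : ∀ t ∈ Icc (0 : ℝ) 1, g t - (z + ψ z) ≠ 0 := fun t ht h0 =>
    hne t ht (sub_eq_zero.2 (injective_add_of_lipschitz hL (sub_eq_zero.1 h0)))
  have hgc : ContinuousOn g (Icc 0 1) :=
    C.continuousOn.add (hψ.continuous.comp_continuousOn C.continuousOn)
  set q : ℝ → ℂ := fun t => (g t - (z + ψ z)) / (C.toFun t - z) with hq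
  have hqc : ContinuousOn q (Icc 0 1) :=
    (hgc.sub continuousOn_const).div (C.continuousOn.sub continuousOn_const) hne
  have hslit : ∀ t ∈ Icc (0 : ℝ) 1, q t ∈ Complex.slitPlane := by
    intro t ht
    have h1 : q t - 1 = (ψ (C.toFun t) - ψ z) / (C.toFun t - z) := by
      rw [hq, hgdef]
      have := hne t ht
      field_simp
      ring
    have h2 : ‖q t - 1‖ < 1 := by
      rw [h1, norm_div, div_lt_one (norm_pos_iff.2 (hne t ht))]
      have h3 := hL.dist_le_mul (C.toFun t) z
      rw [dist_eq_norm, dist_eq_norm] at h3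
      have h4 : (((1 / 2 : NNReal)) : ℝ) = 1 / 2 := by norm_num
      rw [h4] at h3
      linarith [norm_pos_iff.2 (hne t ht)]
    refine Complex.mem_slitPlane_of_norm_lt_one (z := q t - 1) h2 |> fun h => ?_
    rwa [add_sub_cancel] at h
  obtain ⟨S₁, hS₁, hd₁⟩ := C.exists_finite_hasDerivAt
  obtain ⟨S₂, hS₂, hd₂⟩ := hg.exists_finite_hasDerivAt
  have hI₁ : IntervalIntegrable (fun t => deriv C.toFun t / (C.toFun t - z))
      MeasureTheory.volume 0 1 := by
    have h1 : ContinuousOn (fun t => (C.toFun t - z)⁻¹) (Icc 0 1) :=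
      (C.continuousOn.sub continuousOn_const).inv₀ hne
    exact C.intervalIntegrable_deriv.mul_continuousOn (by rwa [uIcc_of_le zero_le_one])
  have hI₂ : IntervalIntegrable (fun t => deriv g t / (g t - (z + ψ z)))
      MeasureTheory.volume 0 1 := by
    have h1 : ContinuousOn (fun t => (g t - (z + ψ z))⁻¹) (Icc 0 1) :=
      (hgc.sub continuousOn_const).inv₀ hne'
    exact hg.intervalIntegrable_deriv.mul_continuousOn (by rwa [uIcc_of_le zero_le_one])
  have hftc := Contour.integral_eq_sub_of_finite (S := S₁ ∪ S₂) (hS₁.union hS₂)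
    (F := fun t => Complex.log (q t))
    (F' := fun t => deriv g t / (g t - (z + ψ z)) - deriv C.toFun t / (C.toFun t - z))
    (hqc.clog hslit) ?_ (hI₂.sub hI₁)
  · have hclosed : q 1 = q 0 := by simp only [hq, hgdef, C.closed]
    rw [hclosed, sub_self, intervalIntegral.integral_sub hI₂ hI₁, sub_eq_zero] at hftc
    rw [windingNumber, windingNumber, hftc]
  · rintro t ⟨ht, htS⟩
    have htI : t ∈ Icc (0 : ℝ) 1 := Ioo_subset_Icc_self ht
    have h1 := (hd₁ t ⟨ht, fun h => htS (Or.inl h)⟩).1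
    have h2 := (hd₂ t ⟨ht, fun h => htS (Or.inr h)⟩).1
    have h3 := ((h2.sub_const (z + ψ z)).div (h1.sub_const z) (hne t htI)).clog_real (hslit t htI)
    refine h3.congr_deriv ?_
    have h4 := hne t htI
    have h5 := hne' t htI
    simp only [Pi.div_apply]
    field_simp

/-- The image of a contour under a perturbation of the identity by a contraction is a contour, whose
inside is the image of the inside. -/
lemma Contour.exists_perturb (C : Contour) (hψ : ContDiff ℝ 1 ψ) (hL : LipschitzWith (1 / 2) ψ) :
    ∃ C' : Contour, C'.image = (fun z => z + ψ z) '' C.image ∧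
      C'.inside = (fun z => z + ψ z) '' C.inside := by
  have hinj := injective_add_of_lipschitz hL
  have hsurj := surjective_add_of_lipschitz hL
  have hΨ : ContDiff ℝ 1 fun z => z + ψ z := contDiff_id.add hψ
  have hpc : PiecewiseC1 fun t => C.toFun t + ψ (C.toFun t) := by
    obtain ⟨n, t, h0, h1, ht⟩ := C.piecewise_C1
    exact ⟨n, t, h0, h1, fun i hi => ⟨(ht i hi).1, hΨ.comp_contDiffOn (ht i hi).2⟩⟩
  have himage : (fun t => C.toFun t + ψ (C.toFun t)) '' Icc 0 1 =
      (fun z => z + ψ z) '' C.image := by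
    rw [Contour.image, image_image]
  have hnot : ∀ z, z + ψ z ∉ (fun t => C.toFun t + ψ (C.toFun t)) '' Icc 0 1 ↔ z ∉ C.image := by
    intro z
    rw [himage, not_iff_not]
    exact hinj.mem_set_image
  have hin : {z | z ∉ (fun t => C.toFun t + ψ (C.toFun t)) '' Icc 0 1 ∧
      windingNumber (fun t => C.toFun t + ψ (C.toFun t)) z = 1} =
      (fun z => z + ψ z) '' C.inside := by
    ext y
    obtain ⟨z, rfl⟩ := hsurj y
    refine Iff.trans ?_ hinj.mem_set_image.symm
    simp only [mem_ofPred_eq, hnot, Contour.inside]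
    exact and_congr_right fun h => by rw [windingNumber_perturb C hψ hL hpc h]
  refine ⟨⟨fun t => C.toFun t + ψ (C.toFun t), ?_, ?_, ?_, hpc, ?_, ?_⟩, himage, hin⟩
  · simp only [C.closed]
  · exact fun a ha b hb hab => C.simple ha hb (hinj hab)
  · exact hΨ.continuous.comp_continuousOn C.continuousOn
  · intro y hy
    obtain ⟨z, rfl⟩ := hsurj y
    have hz := (hnot z).1 hy
    simp only [windingNumber_perturb C hψ hL hpc hz]
    exact C.wind_zero_or_one z hz
  · rw [hin]
    exact C.isConnected_inside'.image _ hΨ.continuous.continuousOn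

end Perturbation

/-- Two points which are close to each other are exchanged by a perturbation of the identity that
is supported in a given ball. -/
lemma exists_push (w₀ : ℂ) {ρ : ℝ} (hρ : 0 < ρ) : ∃ ε > 0, ∀ w ∈ Metric.ball w₀ ε,
    ∀ w' ∈ Metric.ball w₀ ε, ∃ ψ : ℂ → ℂ, ContDiff ℝ 1 ψ ∧ LipschitzWith (1 / 2) ψ ∧
      w + ψ w = w' ∧ ∀ z ∉ Metric.ball w₀ ρ, ψ z = 0 := by
  let χ : ContDiffBump w₀ := ⟨ρ / 4, ρ / 2, by positivity, by linarith⟩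
  have hχ : ContDiff ℝ 1 χ := χ.contDiff
  obtain ⟨L, hL⟩ := hχ.lipschitzWith_of_hasCompactSupport χ.hasCompactSupport one_ne_zero
  refine ⟨min (ρ / 4) (1 / (4 * (L + 1))), by positivity, fun w hw w' hw' => ?_⟩
  have hdist : ‖w' - w‖ ≤ 2 * (1 / (4 * (L + 1))) := by
    rw [Metric.mem_ball] at hw hw'
    have h1 := lt_min_iff.1 hw
    have h2 := lt_min_iff.1 hw'
    rw [← dist_eq_norm]
    linarith [dist_triangle_right w' w w₀]
  refine ⟨fun z => χ z * (w' - w), ?_, ?_, ?_, ?_⟩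
  · exact (Complex.ofRealCLM.contDiff.comp hχ).mul contDiff_const
  · refine LipschitzWith.of_dist_le_mul fun a b => ?_
    have h1 := hL.dist_le_mul a b
    rw [Real.dist_eq] at h1
    rw [dist_eq_norm, ← sub_mul, ← Complex.ofReal_sub, norm_mul, Complex.norm_real,
      Real.norm_eq_abs]
    have h4 : (((1 / 2 : NNReal)) : ℝ) = 1 / 2 := by norm_num
    rw [h4]
    have hLnn : (0 : ℝ) ≤ L := L.coe_nonneg
    calc |χ a - χ b| * ‖w' - w‖ ≤ (L * dist a b) * (2 * (1 / (4 * (L + 1)))) := by gcongr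
      _ = (L / (L + 1)) * (1 / 2 * dist a b) := by field_simp; ring
      _ ≤ 1 * (1 / 2 * dist a b) := by
        gcongr
        rw [div_le_one (by positivity)]
        linarith
      _ = 1 / 2 * dist a b := one_mul _
  · have h1 : χ w = 1 := by
      refine χ.one_of_mem_closedBall ?_
      rw [Metric.mem_ball] at hw
      rw [Metric.mem_closedBall]
      exact (lt_min_iff.1 hw).1.le
    simp only [h1]
    push_cast
    ring
  · intro z hz
    have h1 : χ z = 0 := by
      refine χ.zero_of_le_dist ?_
      rw [Metric.mem_ball, not_lt] at hz
      change ρ / 2 ≤ dist z w₀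
      linarith
    simp [h1]

/-! ### Removing a discrete set from a domain -/

/-- A punctured disc is connected, being the image of a half-plane under the exponential map. -/
lemma isPreconnected_punctured_ball (z : ℂ) {r : ℝ} (hr : 0 < r) :
    IsPreconnected (Metric.ball z r \ {z}) := by
  have h1 : Metric.ball z r \ {z} = (fun w => z + Complex.exp w) '' {w | w.re < Real.log r} := by
    ext y
    constructor
    · rintro ⟨hy, hne⟩
      have hne' : y - z ≠ 0 := sub_ne_zero.2 hne
      refine ⟨Complex.log (y - z), ?_, by simp [Complex.exp_log hne']⟩
      rw [mem_ofPred_eq, Complex.log_re]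
      rw [Metric.mem_ball, dist_eq_norm] at hy
      exact Real.log_lt_log (norm_pos_iff.2 hne') hy
    · rintro ⟨w, hw, rfl⟩
      refine ⟨?_, by simp [Complex.exp_ne_zero]⟩
      rw [Metric.mem_ball, dist_eq_norm, add_sub_cancel_left, Complex.norm_exp]
      exact (Real.lt_log_iff_exp_lt hr).1 hw
  rw [h1]
  exact (convex_halfSpace_re_lt _).isPreconnected.image _ (by fun_prop)

lemma isPreconnected_diff_of_discrete {V Z : Set ℂ} (hV : IsOpen V) (hVc : IsPreconnected V)
    (hZ : ∀ z ∈ V, ∀ᶠ y in 𝓝[≠] z, y ∉ Z) : IsPreconnected (V \ Z) := by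
  rw [isPreconnected_iff_subset_of_disjoint] at hVc ⊢
  intro u v hu hv huv hdisj
  have hgood : ∀ z ∈ V, ∀ᶠ y in 𝓝[≠] z, y ∈ V \ Z := fun z hz =>
    (show ∀ᶠ y in 𝓝[≠] z, y ∈ V from nhdsWithin_le_nhds (hV.mem_nhds hz)).and (hZ z hz)
  have hnot : ∀ z ∈ V, (∀ᶠ y in 𝓝[≠] z, y ∈ u) → (∀ᶠ y in 𝓝[≠] z, y ∈ v) → False := by
    intro z hz h1 h2
    obtain ⟨y, hy, hy1, hy2⟩ := ((hgood z hz).and (h1.and h2)).exists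
    have : y ∈ V \ Z ∩ (u ∩ v) := ⟨hy, hy1, hy2⟩
    rw [hdisj] at this
    exact this
  have hor : ∀ z ∈ V, (∀ᶠ y in 𝓝[≠] z, y ∈ u) ∨ (∀ᶠ y in 𝓝[≠] z, y ∈ v) := by
    intro z hz
    obtain ⟨r, hr, hball⟩ := Metric.mem_nhdsWithin_iff.1 (hgood z hz)
    have hsub : Metric.ball z r \ {z} ⊆ V \ Z := fun y hy => hball ⟨hy.1, hy.2⟩
    have hnhds : Metric.ball z r \ {z} ∈ 𝓝[≠] z :=
      sdiff_mem_nhdsWithin_compl (Metric.ball_mem_nhds z hr) _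
    have h1 := isPreconnected_iff_subset_of_disjoint.1 (isPreconnected_punctured_ball z hr)
      u v hu hv (hsub.trans huv) (subset_empty_iff.1 (hdisj ▸ inter_subset_inter_left _ hsub))
    exact h1.imp (fun h => mem_of_superset hnhds h) (fun h => mem_of_superset hnhds h)
  have hpoint : ∀ u' v' : Set ℂ, IsOpen v' → V \ Z ⊆ u' ∪ v' → V ⊆ {z | ∀ᶠ y in 𝓝[≠] z, y ∈ u'} →
      (∀ z ∈ V, (∀ᶠ y in 𝓝[≠] z, y ∈ u') → (∀ᶠ y in 𝓝[≠] z, y ∈ v') → False) → V \ Z ⊆ u' := by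
    intro u' v' hv' hcov hV' hno y hy
    refine (hcov hy).resolve_right fun hyv => hno y hy.1 (hV' hy.1) ?_
    exact (hv'.eventually_mem hyv).filter_mono nhdsWithin_le_nhds
  rcases hVc _ _ (isOpen_setOfPred_eventually_nhdsWithin (p := fun y => y ∈ u))
    (isOpen_setOfPred_eventually_nhdsWithin (p := fun y => y ∈ v)) (fun z hz => hor z hz)
    (eq_empty_of_forall_notMem fun z hz => hnot z hz.1 hz.2.1 hz.2.2) with h | h
  · exact Or.inl (hpoint u v hv huv h hnot)
  · exact Or.inr (hpoint v u hu (by rwa [union_comm]) h fun z hz h1 h2 => hnot z hz h2 h1)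

section Classes

variable {P : Params} {C : Contour} {Λ : Multiset ℂ}

/-! ### Contour classes of Bethe roots -/

lemma IsBetheContour.order_ne_zero_of_mem (h : IsBetheContour P Λ C) (hν : -P.ν ∉ Λ) {z : ℂ}
    (hz : z ∈ Λ) : meromorphicOrderAt (fun y => 1 + aux P Λ y) z ≠ 0 := by
  rw [h.order_inside z (h.encircles_roots z hz) fun h0 => hν (h0 ▸ hz)]
  have h1 := Multiset.count_ne_zero.2 hz
  exact_mod_cast h1

lemma IsBetheContour.order_neg_ν_ne_zero (h : IsBetheContour P Λ C) :
    meromorphicOrderAt (fun y => 1 + aux P Λ y) (-P.ν) ≠ 0 := by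
  rw [h.order_pole]
  have h1 : -((P.N / 2 : ℕ) : ℤ) ≠ 0 := by
    have := P.half_pos
    omega
  exact_mod_cast h1

/-- Being a contour for given Bethe roots depends only on which roots and poles of `1 + 𝔞` are
encircled. -/
lemma IsBetheContour.of_inside_iff (h : IsBetheContour P Λ C) (hν : -P.ν ∉ Λ) {C' : Contour}
    (hin : ∀ z, meromorphicOrderAt (fun y => 1 + aux P Λ y) z ≠ 0 →
      (z ∈ C'.inside ↔ z ∈ C.inside))
    (him : ∀ z ∈ C'.image, meromorphicOrderAt (fun y => 1 + aux P Λ y) z = 0 ∧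
      meromorphicOrderAt (aux P Λ) z = 0)
    (hS : ShiftsOutside P C') : IsBetheContour P Λ C' := by
  refine ⟨(hin _ h.order_neg_ν_ne_zero).2 h.encircles, h.order_pole,
    fun x hx => (hin x (h.order_ne_zero_of_mem hν hx)).2 (h.encircles_roots x hx), ?_, him, hS⟩
  intro z hz hne
  by_cases h0 : meromorphicOrderAt (fun y => 1 + aux P Λ y) z = 0
  · rw [h0, Multiset.count_eq_zero_of_notMem fun hm => h.order_ne_zero_of_mem hν hm h0]
    rfl
  · exact h.order_inside z ((hin z h0).1 hz) hne

lemma IsBetheContour.mem_inside_of_order_ne_zero (h : IsBetheContour P Λ C) {C' : Contour}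
    (h' : IsBetheContour P Λ C') {z : ℂ}
    (hz : meromorphicOrderAt (fun y => 1 + aux P Λ y) z ≠ 0) (hin : z ∈ C.inside) :
    z ∈ C'.inside := by
  by_cases hne : z = -P.ν
  · rw [hne]
    exact h'.encircles
  · rw [h.order_inside z hin hne] at hz
    refine h'.encircles_roots z (Multiset.count_ne_zero.1 fun h0 => hz ?_)
    rw [h0]
    rfl

/-- The contours for given Bethe roots form one class. -/
lemma IsBetheContour.setOf_eq_contourClass (h : IsBetheContour P Λ C) (hν : -P.ν ∉ Λ) :
    {C' | IsBetheContour P Λ C'} = contourClass P (aux P Λ) C := by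
  ext C'
  constructor
  · intro (h' : IsBetheContour P Λ C')
    exact ⟨h'.isDrivingContour, fun z hz => (h'.on_contour z hz).1,
      fun z hz => ⟨h'.mem_inside_of_order_ne_zero h hz, h.mem_inside_of_order_ne_zero h' hz⟩⟩
  · rintro ⟨hC', him, hin⟩
    have hΛ : ∀ x ∈ Λ, x ∈ C'.inside := fun x hx =>
      (hin x (h.order_ne_zero_of_mem hν hx)).2 (h.encircles_roots x hx)
    refine h.of_inside_iff hν hin (fun z hz => ⟨him z hz, ?_⟩) hC'.shifts
    rw [meromorphicOrderAt_aux hC'.encircles hC'.shifts hΛ (C'.image_subset_region hz),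
      ← meromorphicOrderAt_exp_ε₀]
    exact hC'.on_contour z hz

/-! ### Contours through a given point -/

lemma meromorphicOrderAt_eventually_eq_zero {f : ℂ → ℂ} (hf : MeromorphicOn f univ) {z₀ : ℂ}
    (h₀ : meromorphicOrderAt f z₀ = 0) (z : ℂ) :
    ∀ᶠ y in 𝓝[≠] z, meromorphicOrderAt f y = 0 := by
  have h1 : meromorphicOrderAt f z ≠ ⊤ :=
    hf.meromorphicOrderAt_ne_top_of_isPreconnected isPreconnected_univ
      (mem_univ z₀) (mem_univ z) (by rw [h₀]; exact WithTop.zero_ne_top)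
  have hz := hf z (mem_univ z)
  filter_upwards [hz.eventually_analyticAt,
    (meromorphicOrderAt_ne_top_iff_eventually_ne_zero hz).1 h1] with y hy1 hy2
  exact (meromorphicOrderAt_eq_zero_iff_ne_zero hy1).2 hy2

/-- The region bounded by a contour has a connected open neighbourhood such that the shifts by
`± i γ`, modulo `i π`, of its points are not in it. -/
lemma ShiftsOutside.exists_nhds (h : ShiftsOutside P C) : ∃ V : Set ℂ, IsOpen V ∧
    IsPreconnected V ∧ C.region ⊆ V ∧ ∀ z ∈ V, ∀ k : ℤ,
      z + P.η + k * Real.pi * Complex.I ∉ V ∧ z - P.η + k * Real.pi * Complex.I ∉ V := by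
  have hopen : IsOpen {q : ℂ × ℂ | Complex.sinh (q.1 - q.2 - P.η) ≠ 0 ∧
      Complex.sinh (q.1 - q.2 + P.η) ≠ 0} :=
    (isOpen_ne_fun (by fun_prop) (by fun_prop)).inter (isOpen_ne_fun (by fun_prop) (by fun_prop))
  obtain ⟨u, v, hu, hv, hsu, hsv, huv⟩ := generalized_tube_lemma C.isCompact_region
    C.isCompact_region hopen fun q hq => h.sinh_ne_zero hq.1 hq.2
  have hbase := C.image_subset_region C.base_mem_image
  have hsub : connectedComponentIn (u ∩ v) C.base ⊆ u ∩ v := connectedComponentIn_subset _ _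
  refine ⟨connectedComponentIn (u ∩ v) C.base, (hu.inter hv).connectedComponentIn,
    isPreconnected_connectedComponentIn,
    C.isPreconnected_region.subset_connectedComponentIn hbase (subset_inter hsu hsv), ?_⟩
  intro z hz k
  refine ⟨fun h' => ?_, fun h' => ?_⟩
  · refine (huv (mk_mem_prod (hsub h').1 (hsub hz).2)).1 (sinh_eq_zero_iff.2 ⟨k, ?_⟩)
    ring
  · refine (huv (mk_mem_prod (hsub h').1 (hsub hz).2)).2 (sinh_eq_zero_iff.2 ⟨k, ?_⟩)
    ring

/-- A contour for given Bethe roots can be deformed in a small disc which contains neither roots and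
poles of `1 + 𝔞` nor zeros of `𝔞`. -/
lemma IsBetheContour.exists_perturb (h : IsBetheContour P Λ C) (hν : -P.ν ∉ Λ) {V B : Set ℂ}
    (hV : ∀ z ∈ V, ∀ k : ℤ,
      z + P.η + k * Real.pi * Complex.I ∉ V ∧ z - P.η + k * Real.pi * Complex.I ∉ V)
    (hCV : C.region ⊆ V) (hBV : B ⊆ V)
    (hB : ∀ z ∈ B, meromorphicOrderAt (fun y => 1 + aux P Λ y) z = 0 ∧
      meromorphicOrderAt (aux P Λ) z = 0)
    {ψ : ℂ → ℂ} (hψ : ContDiff ℝ 1 ψ) (hL : LipschitzWith (1 / 2) ψ) (hψB : ∀ z ∉ B, ψ z = 0) :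
    ∃ C', IsBetheContour P Λ C' ∧ C'.region ⊆ V ∧ C'.image = (fun z => z + ψ z) '' C.image := by
  obtain ⟨C', him, hin⟩ := C.exists_perturb hψ hL
  have hinj := injective_add_of_lipschitz hL
  have hfix : ∀ z ∉ B, z + ψ z = z := fun z hz => by rw [hψB z hz, add_zero]
  have hmem : ∀ (S : Set ℂ), ∀ z ∉ B, (z ∈ (fun z => z + ψ z) '' S ↔ z ∈ S) := fun S z hz => by
    conv_lhs => rw [← hfix z hz]
    exact hinj.mem_set_image
  have hmaps : ∀ z ∈ V, z + ψ z ∈ V := by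
    intro z hz
    by_cases hzB : z ∈ B
    · by_contra hnot
      -- a point outside the disc is fixed, so that it is not the image of a point in the disc
      have h1 : z + ψ z ∉ B := fun h' => hnot (hBV h')
      exact h1 (by rwa [show z + ψ z = z from hinj (hfix _ h1)])
    · rwa [hfix z hzB]
  have hregion : C'.region ⊆ V := by
    rw [Contour.region, him, hin, ← image_union]
    rintro _ ⟨z, hz, rfl⟩
    exact hmaps z (hCV hz)
  refine ⟨C', h.of_inside_iff hν (fun z hz => ?_) (fun z hz => ?_) (fun z hz k => ?_), hregion, him⟩
  · rw [hin]
    exact hmem _ z fun hzB => hz (hB z hzB).1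
  · by_cases hzB : z ∈ B
    · exact hB z hzB
    · rw [him, hmem _ z hzB] at hz
      exact h.on_contour z hz
  · have h1 := hV z (hregion (C'.image_subset_region hz)) k
    exact ⟨Contour.notMem_region.1 fun h' => h1.1 (hregion h'),
      Contour.notMem_region.1 fun h' => h1.2 (hregion h')⟩

/-- Through every point inside a contour for given Bethe roots, which is neither a root or pole of
`1 + 𝔞` nor a zero of `𝔞`, there is another contour for the same Bethe roots: these points can be
reached from the contour without crossing the exceptional ones. -/
lemma IsBetheContour.exists_through (h : IsBetheContour P Λ C) (hν : -P.ν ∉ Λ) {p : ℂ}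
    (hp : p ∈ C.inside) (hp₁ : meromorphicOrderAt (fun y => 1 + aux P Λ y) p = 0)
    (hp₂ : meromorphicOrderAt (aux P Λ) p = 0) :
    ∃ C', IsBetheContour P Λ C' ∧ p ∈ C'.image := by
  obtain ⟨V, hVo, hVc, hCV, hV⟩ := h.shifts.exists_nhds
  set Z : Set ℂ := {z | ¬ (meromorphicOrderAt (fun y => 1 + aux P Λ y) z = 0 ∧
    meromorphicOrderAt (aux P Λ) z = 0)} with hZdef
  have hb := h.on_contour _ C.base_mem_image
  have hZ : ∀ z : ℂ, ∀ᶠ y in 𝓝[≠] z, y ∉ Z := fun z => by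
    filter_upwards [meromorphicOrderAt_eventually_eq_zero
      (fun z _ => meromorphicAt_one_add_aux z) hb.1 z,
      meromorphicOrderAt_eventually_eq_zero (meromorphicOn_aux P Λ) hb.2 z] with y h1 h2
    exact fun h' => h' ⟨h1, h2⟩
  have hVZ : IsOpen (V \ Z) := by
    refine isOpen_iff_mem_nhds.2 fun z hz => ?_
    have h1 : ∀ᶠ y in 𝓝 z, y ∉ Z :=
      eventually_nhdsWithin_iff.1 (hZ z) |>.mono fun y hy => by
        by_cases hyz : y = z
        · exact hyz ▸ hz.2
        · exact hy hyz
    filter_upwards [hVo.mem_nhds hz.1, h1] with y hy1 hy2 using ⟨hy1, hy2⟩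
  have hgood : ∀ z ∉ Z, meromorphicOrderAt (fun y => 1 + aux P Λ y) z = 0 ∧
    meromorphicOrderAt (aux P Λ) z = 0 := fun z hz => not_not.1 hz
  let R : ℂ → Prop := fun y => ∃ C', IsBetheContour P Λ C' ∧ C'.region ⊆ V ∧ y ∈ C'.image
  have hloc : ∀ y ∈ V \ Z, ∃ ε > 0, ∀ w ∈ Metric.ball y ε, ∀ w' ∈ Metric.ball y ε, R w → R w' := by
    intro y hy
    obtain ⟨ρ, hρ, hball⟩ := Metric.isOpen_iff.1 hVZ y hy
    obtain ⟨ε, hε, hpush⟩ := exists_push y hρ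
    refine ⟨ε, hε, fun w hw w' hw' ⟨C₁, hC₁, hreg, hmem⟩ => ?_⟩
    obtain ⟨ψ, hψ, hL, hww', hfix⟩ := hpush w hw w' hw'
    obtain ⟨C₂, hC₂, hreg₂, him⟩ := hC₁.exists_perturb hν hV hreg (fun z hz => (hball hz).1)
      (fun z hz => hgood z (hball hz).2) hψ hL hfix
    exact ⟨C₂, hC₂, hreg₂, him ▸ ⟨w, hmem, hww'⟩⟩
  have hopen : IsOpen {y | y ∈ V \ Z ∧ R y} := by
    refine isOpen_iff_mem_nhds.2 fun y ⟨hy, hR⟩ => ?_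
    obtain ⟨ε, hε, hy'⟩ := hloc y hy
    filter_upwards [Metric.ball_mem_nhds y hε, hVZ.mem_nhds hy] with w hw hwV
    exact ⟨hwV, hy' y (Metric.mem_ball_self hε) w hw hR⟩
  have hsub : V \ Z ⊆ {y | y ∈ V \ Z ∧ R y} := by
    refine (isPreconnected_diff_of_discrete hVo hVc fun z _ => hZ z).subset_of_closure_inter_subset
      hopen ?_ ?_
    · have h1 := hCV (C.image_subset_region C.base_mem_image)
      have h2 : C.base ∈ V \ Z := ⟨h1, not_not.2 hb⟩
      exact ⟨C.base, h2, h2, C, h, hCV, C.base_mem_image⟩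
    · rintro y ⟨hcl, hy⟩
      obtain ⟨ε, hε, hy'⟩ := hloc y hy
      obtain ⟨w, hw, hwR⟩ := Metric.mem_closure_iff.1 hcl ε hε
      exact ⟨hy, hy' w (by rwa [Metric.mem_ball']) y (Metric.mem_ball_self hε) hw.2⟩
  obtain ⟨-, C', hC', -, hmem⟩ := hsub ⟨hCV (C.inside_subset_region hp), not_not.2 ⟨hp₁, hp₂⟩⟩
  exact ⟨C', hC', hmem⟩

/-! ### The bijection -/

lemma meromorphicOrderAt_eq_zero_of_one_add_pos {f : ℂ → ℂ} {z : ℂ}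
    (hf : MeromorphicAt (fun y => 1 + f y) z)
    (h : 0 < meromorphicOrderAt (fun y => 1 + f y) z) : meromorphicOrderAt f z = 0 := by
  have h1 : meromorphicOrderAt (fun _ : ℂ => (-1 : ℂ)) z = 0 := by
    classical
    rw [meromorphicOrderAt_const, if_neg (neg_ne_zero.2 one_ne_zero)]
  have h2 := meromorphicOrderAt_add_eq_left_of_lt (f₁ := fun _ => (-1 : ℂ))
    (f₂ := fun y => 1 + f y) (x := z) hf (by rwa [h1])
  rw [← h1, ← h2]
  refine meromorphicOrderAt_congr (Eventually.of_forall fun y => ?_)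
  simp

/-- The contours of a solution determine its Bethe roots: a Bethe root of `Λ₁` which is not one of
`Λ₂` could be crossed by a contour for `Λ₂`, but not by one for `Λ₁`. -/
lemma subset_of_contours_eq {Λ₁ Λ₂ : Multiset ℂ} (h₁ : IsBetheSolution P Λ₁)
    (h₂ : IsBetheSolution P Λ₂) (hC₁ : IsBetheContour P Λ₁ C)
    (heq : {C | IsBetheContour P Λ₁ C} = {C | IsBetheContour P Λ₂ C}) : Λ₁ ⊆ Λ₂ := by
  intro x hx
  by_contra hx₂
  have hC₂ : IsBetheContour P Λ₂ C := heq.subset hC₁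
  have hin := hC₁.encircles_roots x hx
  have hreg := C.inside_subset_region hin
  have hne : x ≠ -P.ν := fun h0 => h₁.neg_ν_notMem (h0 ▸ hx)
  have hord₂ : meromorphicOrderAt (fun y => 1 + aux P Λ₂ y) x = 0 := by
    rw [hC₂.order_inside x hin hne, Multiset.count_eq_zero_of_notMem hx₂]
    rfl
  have hord : meromorphicOrderAt (aux P Λ₂) x = 0 := by
    rw [← hC₂.meromorphicOrderAt_drive hreg, hC₁.meromorphicOrderAt_drive hreg]
    refine meromorphicOrderAt_eq_zero_of_one_add_pos (meromorphicAt_one_add_aux x) ?_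
    rw [hC₁.order_inside x hin hne]
    have := Multiset.count_pos.2 hx
    exact_mod_cast this
  obtain ⟨C', hC', hmem⟩ := hC₂.exists_through h₂.neg_ν_notMem hin hord₂ hord
  have hC'₁ : IsBetheContour P Λ₁ C' := heq.symm.subset hC'
  exact (hC'₁.encircles_roots x hx).1 hmem

theorem bijOn_spinAndContours (P : Params) :
    BijOn (spinAndContours P) (betheSolutions P) (spinContourPairs P) := by
  classical
  refine ⟨?_, ?_, ?_⟩
  · rintro Λ ⟨hB, hnd, C, hC⟩
    refine ⟨aux P Λ, C, meromorphicOn_aux P Λ, hC.isDrivingContour, isSolution_aux hB hC,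
      fun z hz => ?_, hC.setOf_eq_contourClass hB.neg_ν_notMem⟩
    rw [hC.meromorphicOrderAt_eq hB.neg_ν_notMem (C.inside_subset_region hz)]
    have h1 := Multiset.nodup_iff_count_le_one.1 hnd z
    have h2 : (Λ.count z - (poles P).count z : ℤ) ≤ 1 := by omega
    exact_mod_cast h2
  · rintro Λ₁ ⟨h₁, hnd₁, C, hC₁⟩ Λ₂ ⟨h₂, hnd₂, -⟩ heq
    have hset : {C | IsBetheContour P Λ₁ C} = {C | IsBetheContour P Λ₂ C} := congrArg Prod.snd heq
    have hC₂ : IsBetheContour P Λ₂ C := hset.subset hC₁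
    exact le_antisymm ((Multiset.le_iff_subset hnd₁).2 (subset_of_contours_eq h₁ h₂ hC₁ hset))
      ((Multiset.le_iff_subset hnd₂).2 (subset_of_contours_eq h₂ h₁ hC₂ hset.symm))
  · rintro ⟨s, S⟩ ⟨f, C, hf, hC, hsol, hsimple, hS⟩
    obtain ⟨Λ, hB, hΛC, hcard, hfaux⟩ := hsol.exists_betheSolution hC
    have hν := hB.neg_ν_notMem
    have hord : ∀ z, meromorphicOrderAt (fun y => 1 + f y) z =
        meromorphicOrderAt (fun y => 1 + aux P Λ y) z := fun z =>
      meromorphicOrderAt_one_add_congr (eventuallyEq_nhdsNE_of_meromorphic hf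
        (meromorphicOn_aux P Λ) (z₀ := C.base)
        ((eventually_nhdsSet_iff_forall.1 hfaux _ C.base_mem_image).filter_mono
          nhdsWithin_le_nhds) z)
    refine ⟨Λ, ⟨hB, Multiset.nodup_iff_count_le_one.2 fun z => ?_, C, hΛC⟩, ?_⟩
    · by_cases hz : z ∈ Λ
      · have hin := hΛC.encircles_roots z hz
        have h1 := hsimple z hin
        rw [hord, hΛC.order_inside z hin fun h0 => hν (h0 ▸ hz)] at h1
        exact_mod_cast h1
      · rw [Multiset.count_eq_zero_of_notMem hz]
        exact zero_le_one
    · refine Prod.ext ?_ ?_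
      · simp only [spinAndContours]
        omega
      · rw [show S = contourClass P f C from hS]
        refine (hΛC.setOf_eq_contourClass hν).trans ?_
        simp only [contourClass, hord]

end Classes

end XXZ

end

theorem mainTheorem2 (P : XXZ.Params) :
    (∀ (Λ : Multiset ℂ) (C : XXZ.Contour),
      XXZ.IsBetheSolution P Λ → XXZ.IsBetheContour P Λ C →
        XXZ.IsSolution P C (((P.N / 2 : ℕ) : ℤ) - (Λ.card : ℤ)) (XXZ.aux P Λ)) ∧
    (∀ (C : XXZ.Contour) (s : ℤ) (f : ℂ → ℂ),
      XXZ.IsDrivingContour P C → XXZ.IsSolution P C s f →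
        ∃! Λ : Multiset ℂ,
          XXZ.IsBetheSolution P Λ ∧ XXZ.IsBetheContour P Λ C ∧
          (Λ.card : ℤ) = ((P.N / 2 : ℕ) : ℤ) - s ∧
          f =ᶠ[𝓝ˢ C.image] XXZ.aux P Λ) ∧
    Set.BijOn (XXZ.spinAndContours P) (XXZ.betheSolutions P) (XXZ.spinContourPairs P) :=
  ⟨fun _ _ hB h => XXZ.isSolution_aux hB h, fun _ _ _ hC hf => hf.existsUnique_betheSolution hC,
    XXZ.bijOn_spinAndContours P⟩
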